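/- Theorem 3.5. Let $M$ be a smooth manifold of dimension $n\ge 0$ (Hausdorff, without boundary), $\mathcal O(M)$ the poset of its open subsets, $\mathcal B(M)$ a basis of the topology of $M$ all of whose members are diffeomorphic to an open ball of $\mathbb R^n$, $k\ge 0$ an integer, and $\mathcal C$ a category with a zero object and all small limits. All functors below are contravariant. *Definitions.* An inclusion $U\subseteq W$ of open subsets of $M$ is an *isotopy equivalence* if there is a continuous map $L\colon U\times[0,1]\to W$ such that $L_0$ is the inclusion, $L_1(U)=W$, and every $L_t$ is a smooth embedding. A functor to $\mathcal C$ on a subcategory of $\mathcal O(M)$ is *very good* if it sends isotopy equivalences to isomorphisms. For $U\in\mathcal O(M)$ and an integer $m$, let $\mathcal O_m(U)$ be the poset of open subsets of $U$ diffeomorphic to a disjoint union of at most $m$ open balls (empty if $m<0$). For $F\colon\mathcal O(M)\to\mathcal C$ put $T_mF(U)=\lim_{V\in\mathcal O_m(U)}F(V)$; $F$ is *polynomial of degree $\le k$* if the canonical map $F(U)\to T_kF(U)$ is an isomorphism for all $U$. Let $\mathcal F_k(\mathcal O(M);\mathcal C)$ be the category of *very good homogeneous functors of degree $k$*: the functors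 $F\colon\mathcal O(M)\to\mathcal C$ that are very good, polynomial of degree $\le k$, and satisfy $T_{k-1}F(U)\cong 0$ for all $U$; morphisms are natural transformations. Let $\mathcal O^{(k)}(M)$ be the subcategory of $\mathcal O(M)$ whose objects are the open subsets diffeomorphic to a disjoint union of exactly $k$ open balls and whose morphisms are the isotopy equivalences, $\mathcal B^{(k)}(M)$ its full subcategory on the unions of $k$ pairwise disjoint members of $\mathcal B(M)$, and $\mathcal F(\mathcal B^{(k)}(M);\mathcal C)$ the category of very good functors on $\mathcal B^{(k)}(M)$. *Claim.* Restriction to $\mathcal B^{(k)}(M)$ is an equivalence of categories $$\mathcal F_k(\mathcal O(M);\mathcal C)\;\simeq\;\mathcal F(\mathcal B^{(k)}(M);\mathcal C).$$ Its inverse is right Kan extension to $\mathcal O^{(k)}(M)$, then extension by zero to $\mathcal O_k(M)$, then right Kan extension to $\mathcal O(M)$; in particular this construction yields very good functors. That is, for $G\in\mathcal F(\mathcal B^{(k)}(M);\mathcal C)$, a functor $H\colon\mathcal O(M)\to\mathcal C$ and a natural transformation $\alpha\colon H|_{\mathcal B^{(k)}(M)}\to G$, the following are equivalent: 1. $H\in\mathcal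 F_k(\mathcal O(M);\mathcal C)$ and $\alpha$ is an isomorphism; 2. $(H|_{\mathcal O^{(k)}(M)},\alpha)$ is a right Kan extension of $G$ along $\mathcal B^{(k)}(M)\hookrightarrow\mathcal O^{(k)}(M)$, $H(U)\cong 0$ for every $U\in\mathcal O_{k-1}(M)$, and $H$ is polynomial of degree $\le k$ (equivalently, $H$ is the right Kan extension of $H|_{\mathcal O_k(M)}$ along $\mathcal O_k(M)\hookrightarrow\mathcal O(M)$). -/

import Mathlib

open CategoryTheory CategoryTheory.Limits TopologicalSpace Opposite
open scoped Manifold ContDiff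

universe u v w

namespace VeryGood

section Isotopy

variable {n : ℕ}

/-- A smooth embedding between smooth `n`-manifolds: a topological embedding which is smooth and
whose differential is injective at every point. -/
structure IsSmoothEmb {X Y : Type*}
    [TopologicalSpace X] [ChartedSpace (EuclideanSpace ℝ (Fin n)) X]
    [TopologicalSpace Y] [ChartedSpace (EuclideanSpace ℝ (Fin n)) Y] (f : X → Y) : Prop where
  isEmbedding : Topology.IsEmbedding f
  contMDiff : ContMDiff (𝓡 n) (𝓡 n) ∞ f
  injective_mfderiv : ∀ x, Function.Injective (mfderiv (𝓡 n) (𝓡 n) f x)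

theorem IsSmoothEmb.id {X : Type*}
    [TopologicalSpace X] [ChartedSpace (EuclideanSpace ℝ (Fin n)) X] :
    IsSmoothEmb (n := n) (fun x : X => x) := by
  refine ⟨Topology.IsEmbedding.id, contMDiff_id, fun x => ?_⟩
  have h : mfderiv (𝓡 n) (𝓡 n) (fun x : X => x) x = _ := mfderiv_id
  rw [h]
  exact fun a b hab => hab

theorem IsSmoothEmb.comp {X Y Z : Type*}
    [TopologicalSpace X] [ChartedSpace (EuclideanSpace ℝ (Fin n)) X]
    [TopologicalSpace Y] [ChartedSpace (EuclideanSpace ℝ (Fin n)) Y]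
    [TopologicalSpace Z] [ChartedSpace (EuclideanSpace ℝ (Fin n)) Z]
    {g : Y → Z} {f : X → Y} (hg : IsSmoothEmb (n := n) g) (hf : IsSmoothEmb (n := n) f) :
    IsSmoothEmb (n := n) (fun x => g (f x)) := by
  refine ⟨hg.isEmbedding.comp hf.isEmbedding, hg.contMDiff.comp hf.contMDiff, fun x => ?_⟩
  have h : mfderiv (𝓡 n) (𝓡 n) (fun x => g (f x)) x = _ :=
    mfderiv_comp x (hg.contMDiff.mdifferentiable (by simp) (f x))
      (hf.contMDiff.mdifferentiable (by simp) x)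
  rw [h]
  exact (hg.injective_mfderiv (f x)).comp (hf.injective_mfderiv x)

variable {M : Type u} [TopologicalSpace M] [ChartedSpace (EuclideanSpace ℝ (Fin n)) M]

variable (n) in
/-- For open subsets `U, U' ⊆ W` of `M`, an isotopy in `W` from the inclusion `U ↪ W` to the
inclusion `U' ↪ W`: a continuous map `L : U × [0, 1] → W` such that `L_0` is the inclusion of `U`,
`L_1(U) = U'`, and every `L_t` is a smooth embedding. -/
structure IsIsotopy {U U' W : Opens M} (hU : U ≤ W) (hU' : U' ≤ W)
    (L : U × unitInterval → W) : Prop where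
  continuous : Continuous L
  zero : ∀ x : U, L (x, 0) = Opens.inclusion hU x
  one : Set.range (fun x : U => L (x, 1)) = Set.range (Opens.inclusion hU')
  isSmoothEmb : ∀ t : unitInterval, IsSmoothEmb (n := n) (fun x : U => L (x, t))

variable (n) in
/-- `U ⊆ W` and the inclusion `U ↪ W` is an isotopy equivalence, that is, it is isotopic to the
identity `W ↪ W`. -/
def IsIsotopyEquiv (U W : Opens M) : Prop :=
  ∃ (h : U ≤ W) (L : U × unitInterval → W), IsIsotopy n h (le_refl W) L

theorem IsIsotopyEquiv.le {U W : Opens M} (h : IsIsotopyEquiv n U W) : U ≤ W := h.1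

theorem IsIsotopyEquiv.refl (U : Opens M) : IsIsotopyEquiv n U U :=
  ⟨le_refl U, fun p => p.1, continuous_fst, fun _ => rfl, rfl, fun _ => IsSmoothEmb.id⟩

theorem IsIsotopyEquiv.trans {U V W : Opens M} (h₁ : IsIsotopyEquiv n U V)
    (h₂ : IsIsotopyEquiv n V W) : IsIsotopyEquiv n U W := by
  obtain ⟨hUV, L, hL⟩ := h₁
  obtain ⟨hVW, H, hH⟩ := h₂
  let a : unitInterval → unitInterval := fun t => Set.projIcc 0 1 zero_le_one (2 * (t : ℝ))
  let b : unitInterval → unitInterval := fun t => Set.projIcc 0 1 zero_le_one (2 * (t : ℝ) - 1)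
  have ha : Continuous a := by fun_prop
  have hb : Continuous b := by fun_prop
  have a0 : a 0 = 0 := Set.projIcc_of_le_left _ (by simp)
  have b0 : b 0 = 0 := Set.projIcc_of_le_left _ (by simp)
  have a1 : a 1 = 1 := Set.projIcc_of_right_le _ (by simp)
  have b1 : b 1 = 1 := Set.projIcc_of_right_le _ (by norm_num)
  refine ⟨hUV.trans hVW, fun p => H (L (p.1, a p.2), b p.2), ?_, ?_, ?_, ?_⟩
  · exact hH.continuous.comp ((hL.continuous.comp
      (continuous_fst.prodMk (ha.comp continuous_snd))).prodMk (hb.comp continuous_snd))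
  · intro x
    simp only [a0, b0, hL.zero, hH.zero]
  · have e₁ := hL.one
    have e₂ := hH.one
    have i : ∀ X : Opens M, Set.range (Opens.inclusion (le_refl X)) = Set.univ := fun X =>
      Set.range_eq_univ.mpr fun x => ⟨x, rfl⟩
    rw [i, Set.range_eq_univ] at e₁ e₂ ⊢
    simp only [a1, b1]
    exact e₂.comp e₁
  · intro t
    exact (hH.isSmoothEmb (b t)).comp (hL.isSmoothEmb (a t))

variable (n) in
/-- `U` is diffeomorphic to an open ball of `ℝⁿ`. -/
def IsBall (U : Opens M) : Prop :=
  Nonempty (U ≃ₘ^∞⟮𝓡 n, 𝓡 n⟯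
    (⟨Metric.ball 0 1, Metric.isOpen_ball⟩ : Opens (EuclideanSpace ℝ (Fin n))))

/-- `U` is the union of `k` pairwise disjoint members of the family `B` of open sets. -/
def IsDisjUnion (B : Set (Opens M)) (k : ℕ) (U : Opens M) : Prop :=
  ∃ V : Fin k → Opens M, (∀ i, V i ∈ B) ∧ Pairwise (fun i j => Disjoint (V i) (V j)) ∧ U = ⨆ i, V i

variable (n) in
/-- `U` is diffeomorphic to the disjoint union of exactly `k` open balls. -/
def IsBallUnion (k : ℕ) (U : Opens M) : Prop :=
  IsDisjUnion {V : Opens M | IsBall n V} k U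

variable (n) in
/-- `U` is diffeomorphic to the disjoint union of at most `m` open balls. The integer `m` may be
negative, in which case there is no such `U`. -/
def IsBallUnionLE (m : ℤ) (U : Opens M) : Prop :=
  ∃ j : ℕ, (j : ℤ) ≤ m ∧ IsBallUnion n j U

end Isotopy

section Categories

variable (n : ℕ) {M : Type u} [TopologicalSpace M] [ChartedSpace (EuclideanSpace ℝ (Fin n)) M]

/-- The subcategory of the poset of open subsets of `M` whose objects are the open subsets
satisfying `P` and whose morphisms are the inclusions that are isotopy equivalences. -/
structure IsoSub (n : ℕ) {M : Type u} [TopologicalSpace M] (P : Opens M → Prop) where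
  obj : Opens M
  property : P obj

/-- A morphism `U ⟶ V` of `IsoSub n P` exists (and is then unique) exactly when `U ⊆ V` is an
isotopy equivalence; the category structure is the one of a preorder. -/
instance (P : Opens M → Prop) : Preorder (IsoSub n P) where
  le U V := IsIsotopyEquiv n U.obj V.obj
  le_refl U := IsIsotopyEquiv.refl U.obj
  le_trans _ _ _ := IsIsotopyEquiv.trans

/-- The inclusion functor into the poset of open subsets. -/
def IsoSub.ι (P : Opens M → Prop) : IsoSub n P ⥤ Opens M :=
  Monotone.functor (f := IsoSub.obj) fun _ _ h => h.le

/-- The inclusion functor between two such subcategories. -/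
def IsoSub.incl {P Q : Opens M → Prop} (h : ∀ U, P U → Q U) : IsoSub n P ⥤ IsoSub n Q :=
  Monotone.functor (f := fun U => ⟨U.obj, h U.obj U.property⟩) fun _ _ hUV => hUV

/-- `𝓑⁽ᵏ⁾(M)`: disjoint unions of `k` members of `B`, with isotopy equivalences as morphisms. -/
abbrev BasisSub (B : Set (Opens M)) (k : ℕ) := IsoSub n (IsDisjUnion B k)

/-- `𝓞⁽ᵏ⁾(M)`: open subsets diffeomorphic to the disjoint union of exactly `k` balls, with isotopy
equivalences as morphisms. -/
abbrev BallSub (M : Type u) [TopologicalSpace M] [ChartedSpace (EuclideanSpace ℝ (Fin n)) M]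
    (k : ℕ) := IsoSub n (IsBallUnion (M := M) n k)

/-- The inclusion `𝓑⁽ᵏ⁾(M) ⊆ 𝓞⁽ᵏ⁾(M)`, when all members of `B` are diffeomorphic to a ball. -/
def basisIncl {B : Set (Opens M)} (hB : ∀ V ∈ B, IsBall n V) (k : ℕ) :
    BasisSub n B k ⥤ BallSub n M k :=
  IsoSub.incl n fun _ ⟨V, hV, hd, hU⟩ => ⟨V, fun i => hB _ (hV i), hd, hU⟩

/-- `𝓞_m(U)`, as a full subcategory of the poset of open subsets of `M`: the open subsets of `U`
that are diffeomorphic to the disjoint union of at most `m` balls. -/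
abbrev SmallOpens (m : ℤ) (U : Opens M) :=
  ObjectProperty.FullSubcategory (C := Opens M) fun V => V ≤ U ∧ IsBallUnionLE n m V

variable {C : Type v} [Category.{w} C]

/-- Let `ι : A ⥤ 𝓞(M)` be (the inclusion of) a subcategory. A contravariant functor on `A` is very
good if it sends isotopy equivalences to isomorphisms. -/
def IsVeryGood {A : Type*} [Category A] (ι : A ⥤ Opens M) : ObjectProperty (Aᵒᵖ ⥤ C) :=
  fun F => ∀ ⦃a b : A⦄ (f : a ⟶ b), IsIsotopyEquiv n (ι.obj a) (ι.obj b) → IsIso (F.map f.op)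

variable (C) in
/-- The category `𝓕(𝓑⁽ᵏ⁾(M); C)` of very good functors on `𝓑⁽ᵏ⁾(M)`. -/
abbrev VGBasis (B : Set (Opens M)) (k : ℕ) :=
  (IsVeryGood (C := C) n (IsoSub.ι n (IsDisjUnion B k))).FullSubcategory

/-- The restriction of `F` to `𝓞_m(U)`. -/
abbrev smallDiagram (F : (Opens M)ᵒᵖ ⥤ C) (m : ℤ) (U : Opens M) : (SmallOpens n m U)ᵒᵖ ⥤ C :=
  (ObjectProperty.ι _).op ⋙ F

/-- The cone with apex `F(U)` over the restriction of `F` to `𝓞_m(U)`, given by the restriction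
maps `F(U) ⟶ F(V)`. -/
def smallCone (F : (Opens M)ᵒᵖ ⥤ C) (m : ℤ) (U : Opens M) : Cone (smallDiagram n F m U) where
  pt := F.obj (op U)
  π :=
    { app := fun V => F.map (homOfLE V.unop.property.1).op
      naturality := fun V W f => by
        simp only [Functor.const_obj_obj, Functor.const_obj_map, Category.id_comp,
          Functor.comp_map]
        exact (congrArg F.map (Subsingleton.elim _ _)).trans (F.map_comp _ _) }

variable [HasLimitsOfSize.{u, u} C]

/-- The value at `U` of the `m`-th polynomial approximation `T_m F` of `F`, the limit of `F(V)`
over `V ∈ 𝓞_m(U)`. -/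
noncomputable def polyApprox (F : (Opens M)ᵒᵖ ⥤ C) (m : ℤ) (U : Opens M) : C :=
  limit (smallDiagram n F m U)

/-- The canonical map `F(U) ⟶ T_m F(U)`. -/
noncomputable def toPolyApprox (F : (Opens M)ᵒᵖ ⥤ C) (m : ℤ) (U : Opens M) :
    F.obj (op U) ⟶ polyApprox n F m U :=
  limit.lift (smallDiagram n F m U) (smallCone n F m U)

/-- `F` is polynomial of degree `≤ k`: it is determined by its values on `𝓞_k(M)`, in the sense
that `F(U)` is the limit of `F(V)` over `V ∈ 𝓞_k(U)`, for every `U`. -/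
def IsPolynomial (k : ℕ) (F : (Opens M)ᵒᵖ ⥤ C) : Prop :=
  ∀ U : Opens M, IsIso (toPolyApprox n F k U)

/-- Very good homogeneous functors of degree `k`: very good, polynomial of degree `≤ k`, and with
`T_{k-1} F(U)` a zero object for every `U`. -/
def IsVGHomogeneous (k : ℕ) : ObjectProperty ((Opens M)ᵒᵖ ⥤ C) := fun F =>
  IsVeryGood n (𝟭 (Opens M)) F ∧ IsPolynomial n k F ∧
    ∀ U : Opens M, IsZero (polyApprox n F ((k : ℤ) - 1) U)

variable (M C) in
/-- The category `𝓕_k(𝓞(M); C)` of very good homogeneous functors of degree `k`. -/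
abbrev VGHomogeneous (k : ℕ) :=
  (IsVGHomogeneous (M := M) (C := C) n k).FullSubcategory

variable (C) in
/-- The restriction functor `𝓕_k(𝓞(M); C) ⥤ 𝓕(𝓑⁽ᵏ⁾(M); C)`. -/
def restriction (B : Set (Opens M)) (k : ℕ) : VGHomogeneous n M C k ⥤ VGBasis n C B k :=
  ObjectProperty.lift _
    ((IsVGHomogeneous n k).ι ⋙
      (Functor.whiskeringLeft _ _ C).obj (IsoSub.ι n (IsDisjUnion B k)).op)
    fun F _ _ f hf => F.property.1 ((IsoSub.ι n (IsDisjUnion B k)).map f) hf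

end Categories

end VeryGood

/-! The proof replaces functors by coverings of configuration spaces. Fix a test object `Z` of `C`.
A functor `G` on unions of `k` basis balls that inverts isotopy equivalences gives a locally
constant family of sets on the space `Conf k M` of ordered configurations: the germs at `x` are the
morphisms `Z ⟶ G U`, where `U` is a union of `k` balls, each containing one point of `x`. The germs
form a covering space (`LocalSystem.isCoveringMap_proj`), and by Yoneda it suffices to argue with
its sections.

Kan extension to unions of `k` balls. A point of the limit at `V = T₁ ⊔ … ⊔ T_k` is a section over
the cell of configurations with `i`-th point in `T i`. This cell is homeomorphic to a Euclidean
space, so a section exists through every germ and is determined by it. Hence the limit maps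
isomorphically to each value of `G` in its diagram (`isIso_π_app`), and the extension is again very
good and restricts to `G`.

Extension to all open sets. If `H` is polynomial of degree `≤ k` and zero on fewer than `k` balls,
then morphisms `Z ⟶ H U` are the continuous sections over `Conf k U` that are equivariant under
reordering and vanish on configurations lying in fewer than `k` balls of `U` (`eq_of_toSection_eq`,
`exists_toSection_eq`). An isotopy from `U` to `W` moves configurations, and homotopy lifting
transports sections along it, so `H W ⟶ H U` is an isomorphism (`isIso_map_of_isIsotopyEquiv`).

Morphisms and extension by zero. An inclusion between unions of `k` balls induces a map of
components. If this map is bijective, the Alexander trick makes the inclusion an isotopy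
equivalence; otherwise the inclusion factors through fewer balls and a homogeneous functor sends it
to zero (`isIsotopyEquiv_or_factors`). So only the isotopy equivalences carry information. -/

namespace VeryGood

/-! ### Local diffeomorphisms and inclusions of open sets -/

section LocalDiffeomorphisms

variable {n : ℕ}

theorem IsSmoothEmb.of_isLocalDiffeomorph {X Y : Type*}
    [TopologicalSpace X] [ChartedSpace (EuclideanSpace ℝ (Fin n)) X]
    [TopologicalSpace Y] [ChartedSpace (EuclideanSpace ℝ (Fin n)) Y] {f : X → Y}
    (hf : IsLocalDiffeomorph (𝓡 n) (𝓡 n) ∞ f) (hinj : Function.Injective f) :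
    IsSmoothEmb (n := n) f where
  isEmbedding := (hf.isLocalHomeomorph.isOpenEmbedding_of_injective hinj).isEmbedding
  contMDiff := hf.contMDiff
  injective_mfderiv x := by
    rw [← (hf x).mfderivToContinuousLinearEquiv_coe (by simp)]
    exact ((hf x).mfderivToContinuousLinearEquiv (by simp)).injective

section

variable {X Y Z : Type*}
    [TopologicalSpace X] [ChartedSpace (EuclideanSpace ℝ (Fin n)) X]
    [TopologicalSpace Y] [ChartedSpace (EuclideanSpace ℝ (Fin n)) Y]
    [TopologicalSpace Z] [ChartedSpace (EuclideanSpace ℝ (Fin n)) Z]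

/-- Precompose with a local inverse of `j`. This lets a glued map be tested on each piece of a
disjoint union. -/
theorem isLocalDiffeomorphAt_of_comp {f : Y → Z} {j : X → Y} {x : X}
    (hfj : IsLocalDiffeomorphAt (𝓡 n) (𝓡 n) ∞ (fun y => f (j y)) x)
    (hj : IsLocalDiffeomorphAt (𝓡 n) (𝓡 n) ∞ j x) :
    IsLocalDiffeomorphAt (𝓡 n) (𝓡 n) ∞ f (j x) := by
  obtain ⟨Φ, hxΦ, hΦ⟩ := hfj
  obtain ⟨Ψ, hxΨ, hΨ⟩ := hj
  have hjx : j x = Ψ.toPartialEquiv x := hΨ hxΨ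
  refine ⟨Ψ.symm.trans Φ, ?_, ?_⟩
  · refine ⟨?_, ?_⟩
    · rw [hjx]; exact Ψ.map_source' hxΨ
    · rw [hjx]
      change Ψ.invFun (Ψ.toPartialEquiv x) ∈ Φ.source
      rw [Ψ.left_inv' hxΨ]; exact hxΦ
  · rintro y ⟨hy, hy'⟩
    have hy1 : y ∈ Ψ.target := hy
    have hy2 : Ψ.invFun y ∈ Φ.source := hy'
    have h1 := hΦ hy2
    simp only at h1
    rw [hΨ (Ψ.map_target' hy1), Ψ.right_inv' hy1] at h1
    exact h1

theorem isLocalDiffeomorph_comp {g : Y → Z} {f : X → Y}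
    (hg : IsLocalDiffeomorph (𝓡 n) (𝓡 n) ∞ g) (hf : IsLocalDiffeomorph (𝓡 n) (𝓡 n) ∞ f) :
    IsLocalDiffeomorph (𝓡 n) (𝓡 n) ∞ (fun x => g (f x)) :=
  fun x => (hf x).comp _ _ (hg (f x))

end

variable {M : Type u} [TopologicalSpace M] [ChartedSpace (EuclideanSpace ℝ (Fin n)) M]

theorem isLocalDiffeomorph_inclusion {U V : Opens M} (h : U ≤ V) :
    IsLocalDiffeomorph (𝓡 n) (𝓡 n) ∞ (Opens.inclusion h) := by
  classical
  intro x
  let Φ : PartialDiffeomorph (𝓡 n) (𝓡 n) U V ∞ :=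
    { toFun := Opens.inclusion h
      -- The value off the target is irrelevant; `x` is merely a point of `U` at hand.
      invFun := fun y => if hy : y.1 ∈ U then ⟨y.1, hy⟩ else x
      source := Set.univ
      target := {y | y.1 ∈ U}
      map_source' := fun y _ => y.2
      map_target' := fun _ _ => Set.mem_univ _
      left_inv' := fun y _ => by
        have : ((Opens.inclusion h y : V) : M) ∈ U := y.2
        simp only [dif_pos this]
      right_inv' := fun y hy => by
        have : (y : M) ∈ U := hy
        simp only [dif_pos this]
        rfl
      open_source := isOpen_univ
      open_target := U.isOpen.preimage continuous_subtype_val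
      contMDiffOn_toFun := (contMDiff_inclusion h).contMDiffOn
      contMDiffOn_invFun := by
        intro y hy
        rw [← ContMDiffWithinAt.subtypeVal_comp_iff]
        refine (contMDiff_subtype_val (I := 𝓡 n) (n := ∞) (U := V)
          y).contMDiffWithinAt.congr ?_ ?_
        · intro z hz
          have : (z : M) ∈ U := hz
          simp only [Function.comp_apply, dif_pos this]
        · have : (y : M) ∈ U := hy
          simp only [Function.comp_apply, dif_pos this] }
  exact ⟨Φ, Set.mem_univ _, fun _ _ => rfl⟩

end LocalDiffeomorphisms

/-! ### The Alexander trick: deforming an open embedding of Euclidean space to an affine map -/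

section Alexander

variable {n : ℕ}

/-- The interpolation `(x, t) ↦ j 0 + (j (t x) - j 0) / t` between a map `j` (at `t = 1`) and its
affine approximation at the origin (at `t = 0`). -/
noncomputable def alexander (j : EuclideanSpace ℝ (Fin n) → EuclideanSpace ℝ (Fin n)) (t : ℝ)
    (x : EuclideanSpace ℝ (Fin n)) : EuclideanSpace ℝ (Fin n) :=
  j 0 + ∫ s in (0 : ℝ)..1, fderiv ℝ j (s • t • x) x

variable {j : EuclideanSpace ℝ (Fin n) → EuclideanSpace ℝ (Fin n)}

/-- The integral form has no division by `t`, so joint continuity at `t = 0` comes from that of the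
integrand. -/
theorem continuous_alexander (hj : ContDiff ℝ ∞ j) :
    Continuous fun p : EuclideanSpace ℝ (Fin n) × ℝ => alexander j p.2 p.1 := by
  refine continuous_const.add
    (intervalIntegral.continuous_parametric_intervalIntegral_of_continuous' ?_ 0 1)
  have := hj.continuous_fderiv (by simp)
  simp only [Function.uncurry_def]
  fun_prop

theorem alexander_zero (x : EuclideanSpace ℝ (Fin n)) :
    alexander j 0 x = j 0 + fderiv ℝ j 0 x := by
  simp [alexander]

/-- The fundamental theorem of calculus along the segment `s ↦ s • t • x`. -/
theorem alexander_of_ne_zero (hj : ContDiff ℝ ∞ j) {t : ℝ} (ht : t ≠ 0)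
    (x : EuclideanSpace ℝ (Fin n)) :
    alexander j t x = j 0 + t⁻¹ • (j (t • x) - j 0) := by
  have hd : ∀ s : ℝ, HasDerivAt (fun s : ℝ => j (s • t • x)) (fderiv ℝ j (s • t • x) (t • x)) s := by
    intro s
    have h1 : HasDerivAt (fun s : ℝ => s • t • x) (t • x) s := by
      simpa using (hasDerivAt_id s).smul_const (t • x)
    exact ((hj.differentiable (by simp)) _).hasFDerivAt.comp_hasDerivAt s h1
  have hc : Continuous fun s : ℝ => fderiv ℝ j (s • t • x) (t • x) := by
    have := hj.continuous_fderiv (by simp)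
    fun_prop
  have h := intervalIntegral.integral_eq_sub_of_hasDerivAt (a := 0) (b := 1)
    (fun s _ => hd s) (hc.intervalIntegrable 0 1)
  simp only [one_smul, zero_smul, map_smul, intervalIntegral.integral_smul] at h
  rw [alexander, ← h, smul_smul, inv_mul_cancel₀ ht, one_smul]

theorem alexander_one (hj : ContDiff ℝ ∞ j) (x : EuclideanSpace ℝ (Fin n)) :
    alexander j 1 x = j x := by
  simp [alexander_of_ne_zero hj one_ne_zero]

/-- The affine map `x ↦ a + A x` as a diffeomorphism. -/
noncomputable def affineDiffeo (a : EuclideanSpace ℝ (Fin n))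
    (A : EuclideanSpace ℝ (Fin n) ≃L[ℝ] EuclideanSpace ℝ (Fin n)) :
    EuclideanSpace ℝ (Fin n) ≃ₘ^∞⟮𝓡 n, 𝓡 n⟯ EuclideanSpace ℝ (Fin n) where
  toFun x := a + A x
  invFun y := A.symm (y - a)
  left_inv x := by simp
  right_inv x := by simp
  contMDiff_toFun := (contDiff_const.add A.contDiff).contMDiff
  contMDiff_invFun := (A.symm.contDiff.comp (contDiff_id.sub contDiff_const)).contMDiff

variable (hj : IsLocalDiffeomorph (𝓡 n) (𝓡 n) ∞ j)
include hj

theorem alexander_zero_eq_affineDiffeo :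
    ∃ A, alexander j 0 = affineDiffeo (j 0) A := by
  refine ⟨(hj 0).mfderivToContinuousLinearEquiv (by simp), ?_⟩
  ext1 x
  rw [alexander_zero]
  have h := DFunLike.congr_fun ((hj 0).mfderivToContinuousLinearEquiv_coe (by simp)) x
  rw [mfderiv_eq_fderiv] at h
  exact congrArg (j 0 + ·) h.symm

theorem isLocalDiffeomorph_alexander (t : ℝ) :
    IsLocalDiffeomorph (𝓡 n) (𝓡 n) ∞ (alexander j t) := by
  by_cases ht : t = 0
  · subst ht
    obtain ⟨A, hA⟩ := alexander_zero_eq_affineDiffeo hj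
    rw [hA]
    exact Diffeomorph.isLocalDiffeomorph _
  · let S := ContinuousLinearEquiv.smulLeft (R₁ := ℝ) (M₁ := EuclideanSpace ℝ (Fin n)) (Units.mk0 t ht)
    -- For `t ≠ 0` the interpolation is `j` between two affine diffeomorphisms: scaling by `t`, then
    -- scaling by `t⁻¹` with a translation.
    have : alexander j t = fun x => affineDiffeo (j 0 - t⁻¹ • j 0) S.symm (j (affineDiffeo 0 S x)) := by
      ext1 x
      rw [alexander_of_ne_zero hj.contMDiff.contDiff ht]
      have h1 : affineDiffeo 0 S x = t • x := by
        change 0 + t • x = _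
        simp
      rw [h1]
      change _ = j 0 - t⁻¹ • j 0 + t⁻¹ • j (t • x)
      rw [smul_sub]; abel
    rw [this]
    exact isLocalDiffeomorph_comp (Diffeomorph.isLocalDiffeomorph _)
      (isLocalDiffeomorph_comp hj (Diffeomorph.isLocalDiffeomorph _))

theorem injective_alexander (hinj : Function.Injective j) (t : ℝ) :
    Function.Injective (alexander j t) := by
  by_cases ht : t = 0
  · subst ht
    obtain ⟨A, hA⟩ := alexander_zero_eq_affineDiffeo hj
    rw [hA]
    exact (affineDiffeo (j 0) A).injective
  · intro x y hxy
    rw [alexander_of_ne_zero hj.contMDiff.contDiff ht,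
      alexander_of_ne_zero hj.contMDiff.contDiff ht] at hxy
    have h1 := smul_right_injective _ (inv_ne_zero ht) (add_left_cancel hxy)
    exact smul_right_injective _ ht (hinj (sub_left_injective h1))

theorem surjective_alexander_zero : Function.Surjective (alexander j 0) := by
  obtain ⟨A, hA⟩ := alexander_zero_eq_affineDiffeo hj
  rw [hA]
  exact (affineDiffeo (j 0) A).surjective

end Alexander

/-! ### Nested balls and their disjoint unions are isotopy equivalent -/

section Balls

variable {n : ℕ} {M : Type u} [TopologicalSpace M] [ChartedSpace (EuclideanSpace ℝ (Fin n)) M]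

variable (n) in
/-- The open unit ball of Euclidean space is diffeomorphic to the whole space. -/
noncomputable def unitBallDiffeo :
    EuclideanSpace ℝ (Fin n) ≃ₘ^∞⟮𝓡 n, 𝓡 n⟯
    (⟨Metric.ball 0 1, Metric.isOpen_ball⟩ : Opens (EuclideanSpace ℝ (Fin n))) where
  toFun x := ⟨OpenPartialHomeomorph.univUnitBall x,
    OpenPartialHomeomorph.univUnitBall.map_source' (Set.mem_univ x)⟩
  invFun y := OpenPartialHomeomorph.univUnitBall.symm y.1
  left_inv x := OpenPartialHomeomorph.univUnitBall.left_inv' (Set.mem_univ x)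
  right_inv y := Subtype.ext (OpenPartialHomeomorph.univUnitBall.right_inv' y.2)
  contMDiff_toFun := by
    rw [← ContMDiff.subtypeVal_comp_iff]
    exact OpenPartialHomeomorph.contDiff_univUnitBall.contMDiff
  contMDiff_invFun := by
    intro y
    refine contMDiffAt_subtype_iff (f := OpenPartialHomeomorph.univUnitBall.symm).mpr ?_
    exact (OpenPartialHomeomorph.contDiffOn_univUnitBall_symm.contDiffAt
      (Metric.isOpen_ball.mem_nhds y.2)).contMDiffAt

theorem IsBall.nonempty_diffeo {U : Opens M} (hU : IsBall n U) :
    Nonempty (EuclideanSpace ℝ (Fin n) ≃ₘ^∞⟮𝓡 n, 𝓡 n⟯ U) := by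
  obtain ⟨e⟩ := hU
  exact ⟨(unitBallDiffeo n).trans e.symm⟩

variable (n) in
/-- The inclusion `U ↪ W` is isotopic to a diffeomorphism through injective local
diffeomorphisms. -/
def IsOpenIsotopyEquiv (U W : Opens M) : Prop :=
  ∃ (h : U ≤ W) (L : U × unitInterval → W), Continuous L ∧
    (∀ x, L (x, 0) = Opens.inclusion h x) ∧ Function.Surjective (fun x => L (x, 1)) ∧
    ∀ t, Function.Injective (fun x => L (x, t)) ∧
      IsLocalDiffeomorph (𝓡 n) (𝓡 n) ∞ (fun x => L (x, t))

/-- In coordinates the inclusion is an open embedding `j` of Euclidean space in itself. Running the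
interpolation backwards, with parameter `1 - t`, starts at `j` and ends at an affine isomorphism,
which is onto. -/
theorem IsOpenIsotopyEquiv.of_diffeo {U V : Opens M} (h : U ≤ V)
    (eU : EuclideanSpace ℝ (Fin n) ≃ₘ^∞⟮𝓡 n, 𝓡 n⟯ U)
    (eV : EuclideanSpace ℝ (Fin n) ≃ₘ^∞⟮𝓡 n, 𝓡 n⟯ V) : IsOpenIsotopyEquiv n U V := by
  obtain ⟨j, hje⟩ : ∃ j : EuclideanSpace ℝ (Fin n) → EuclideanSpace ℝ (Fin n),
      ∀ x, j x = eV.symm (Opens.inclusion h (eU x)) := ⟨_, fun _ => rfl⟩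
  have hj : IsLocalDiffeomorph (𝓡 n) (𝓡 n) ∞ j := by
    rw [funext hje]
    exact isLocalDiffeomorph_comp eV.symm.isLocalDiffeomorph
      (isLocalDiffeomorph_comp (isLocalDiffeomorph_inclusion h) eU.isLocalDiffeomorph)
  have hinj : Function.Injective j := by
    intro x y hxy
    rw [hje, hje] at hxy
    exact eU.injective (Set.inclusion_injective h (eV.symm.injective hxy))
  have hs : ContDiff ℝ ∞ j := hj.contMDiff.contDiff
  refine ⟨h, fun p => eV (alexander j (1 - (p.2 : ℝ)) (eU.symm p.1)), ?_, ?_, ?_, ?_⟩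
  · have h1 : Continuous fun p : U × unitInterval => (eU.symm p.1, 1 - (p.2 : ℝ)) :=
      (eU.symm.continuous.comp continuous_fst).prodMk (by fun_prop)
    have h2 := (continuous_alexander hs).comp h1
    exact eV.continuous.comp h2
  · intro x
    simp [alexander_one hs, hje]
  · simp only [Set.Icc.coe_one, sub_self]
    intro y
    obtain ⟨x, hx⟩ := surjective_alexander_zero hj (eV.symm y)
    exact ⟨eU x, by simp only [Diffeomorph.symm_apply_apply, hx, Diffeomorph.apply_symm_apply]⟩
  · intro t
    have h1 : IsLocalDiffeomorph (𝓡 n) (𝓡 n) ∞ fun x => alexander j (1 - (t : ℝ)) (eU.symm x) :=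
      isLocalDiffeomorph_comp (g := alexander j (1 - (t : ℝ)))
        (isLocalDiffeomorph_alexander hj _) eU.symm.isLocalDiffeomorph
    exact ⟨fun x y hxy => eU.symm.injective (injective_alexander hj hinj _ (eV.injective hxy)),
      isLocalDiffeomorph_comp eV.isLocalDiffeomorph h1⟩

theorem IsBall.isOpenIsotopyEquiv {U V : Opens M} (hU : IsBall n U) (hV : IsBall n V)
    (h : U ≤ V) : IsOpenIsotopyEquiv n U V := by
  obtain ⟨eU⟩ := hU.nonempty_diffeo
  obtain ⟨eV⟩ := hV.nonempty_diffeo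
  exact .of_diffeo h eU eV

/-- The isotopies are glued piece by piece: since the `T' i` are disjoint, so are the `T i`, and
each piece is open, so every property except injectivity and surjectivity is local. Injectivity
across pieces holds because the images stay in disjoint `T' i`. -/
theorem isIsotopyEquiv_iSup {ι : Type*} {T T' : ι → Opens M}
    (hT' : Pairwise fun i j => Disjoint (T' i) (T' j))
    (h : ∀ i, IsOpenIsotopyEquiv n (T i) (T' i)) : IsIsotopyEquiv n (⨆ i, T i) (⨆ i, T' i) := by
  choose hle L hLc hL0 hL1 hLt using h
  have hmem : ∀ x : (⨆ i, T i : Opens M), ∃ i, (x : M) ∈ T i := fun x => Opens.mem_iSup.mp x.2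
  choose a ha using hmem
  have uniq : ∀ {i j : ι} {x : M}, x ∈ T' i → x ∈ T' j → i = j := by
    intro i j x hi hj
    by_contra hij
    exact (Set.disjoint_left.mp (Opens.coe_disjoint.mpr (hT' hij))) hi hj
  let F : (⨆ i, T i : Opens M) × unitInterval → (⨆ i, T' i : Opens M) := fun p =>
    Opens.inclusion (le_iSup T' (a p.1)) (L (a p.1) (⟨p.1, ha p.1⟩, p.2))
  have hF : ∀ (i : ι) (x : T i) (t : unitInterval),
      F (Opens.inclusion (le_iSup T i) x, t) = Opens.inclusion (le_iSup T' i) (L i (x, t)) := by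
    intro i x t
    have e : a (Opens.inclusion (le_iSup T i) x) = i :=
      uniq (hle _ (ha (Opens.inclusion (le_iSup T i) x))) (hle i x.2)
    have key : ∀ (i' : ι) (hi' : (x : M) ∈ T i'), i' = i →
        Opens.inclusion (le_iSup T' i') (L i' (⟨x, hi'⟩, t)) =
          Opens.inclusion (le_iSup T' i) (L i (x, t)) := by
      rintro i' hi' rfl
      rfl
    exact key _ (ha (Opens.inclusion (le_iSup T i) x)) e
  have hsurj : ∀ x : (⨆ i, T i : Opens M), ∃ i, ∃ y : T i, x = Opens.inclusion (le_iSup T i) y :=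
    fun x => ⟨a x, ⟨x, ha x⟩, rfl⟩
  refine ⟨iSup_mono hle, F, ?_, ?_, ?_, ?_⟩
  · rw [continuous_iff_continuousAt]
    rintro ⟨x, t⟩
    obtain ⟨i, y, rfl⟩ := hsurj x
    have ho : Topology.IsOpenEmbedding
        (Prod.map (Opens.inclusion (le_iSup T i)) (id : unitInterval → unitInterval)) :=
      (Opens.isOpenEmbedding_of_le (le_iSup T i)).prodMap .id
    refine (ho.continuousAt_iff (x := (y, t))).mp ?_
    have : F ∘ Prod.map (Opens.inclusion (le_iSup T i)) id =
        fun p => Opens.inclusion (le_iSup T' i) (L i p) := by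
      ext1 p; exact hF i p.1 p.2
    rw [this]
    exact ((continuous_inclusion (le_iSup T' i)).comp (hLc i)).continuousAt
  · intro x
    obtain ⟨i, y, rfl⟩ := hsurj x
    rw [hF, hL0]
  · rw [Set.range_eq_univ.mpr, Set.range_eq_univ.mpr]
    · intro x; exact ⟨x, rfl⟩
    · intro x
      obtain ⟨i, hi⟩ := Opens.mem_iSup.mp x.2
      obtain ⟨y, hy⟩ := hL1 i ⟨x, hi⟩
      refine ⟨Opens.inclusion (le_iSup T i) y, ?_⟩
      simp only at hy ⊢
      rw [hF, hy]
      rfl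
  · intro t
    apply IsSmoothEmb.of_isLocalDiffeomorph
    · intro x
      obtain ⟨i, y, rfl⟩ := hsurj x
      refine isLocalDiffeomorphAt_of_comp ?_ (isLocalDiffeomorph_inclusion _ y)
      simp only [hF]
      exact isLocalDiffeomorph_comp (isLocalDiffeomorph_inclusion _) (hLt i t).2 y
    · intro x x' hxx'
      obtain ⟨i, y, rfl⟩ := hsurj x
      obtain ⟨i', y', rfl⟩ := hsurj x'
      simp only [hF] at hxx'
      have hv := congrArg Subtype.val hxx'
      have hii : i = i' := uniq (L i (y, t)).2 (by
        have : ((L i (y, t) : T' i) : M) = (L i' (y', t) : T' i') := hv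
        rw [this]; exact (L i' (y', t)).2)
      subst hii
      rw [(hLt i t).1 (Subtype.ext hv)]

theorem isIsotopyEquiv_iSup_of_isBall {ι : Type*} {T T' : ι → Opens M}
    (hT : ∀ i, IsBall n (T i)) (hT' : ∀ i, IsBall n (T' i))
    (hd : Pairwise fun i j => Disjoint (T' i) (T' j)) (h : ∀ i, T i ≤ T' i) :
    IsIsotopyEquiv n (⨆ i, T i) (⨆ i, T' i) :=
  isIsotopyEquiv_iSup hd fun i => (hT i).isOpenIsotopyEquiv (hT' i) (h i)

end Balls

/-! ### The covering space of germs of a locally constant family -/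

/-- A locally constant family of sets on a space `X`, presented by sets `A p` attached to a directed
family of open subsets `base p`, with bijective restriction maps. -/
structure LocalSystem (X : Type*) [TopologicalSpace X] (P : Type*) [Preorder P] where
  base : P → Set X
  isOpen_base : ∀ p, IsOpen (base p)
  A : P → Type w
  res : ∀ {p q}, p ≤ q → A q → A p
  res_res : ∀ {p q r} (h : p ≤ q) (h' : q ≤ r) (a : A r), res h (res h' a) = res (h.trans h') a
  bijective_res : ∀ {p q} (h : p ≤ q), Function.Bijective (res h)
  directed : ∀ {p q x}, x ∈ base p → x ∈ base q → ∃ r, r ≤ p ∧ r ≤ q ∧ x ∈ base r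
  cover : ∀ x, ∃ p, x ∈ base p

namespace LocalSystem

variable {X : Type*} [TopologicalSpace X] {P : Type*} [Preorder P] (S : LocalSystem.{w} X P)

/-- Representatives of germs. -/
structure PreGerm where
  idx : P
  pt : X
  mem : pt ∈ S.base idx
  val : S.A idx

/-- Two representatives define the same germ if they agree on a common refinement. -/
instance germSetoid : Setoid S.PreGerm where
  r a b := a.pt = b.pt ∧ ∃ r, ∃ (h : r ≤ a.idx) (h' : r ≤ b.idx), a.pt ∈ S.base r ∧
    S.res h a.val = S.res h' b.val
  iseqv :=
    { refl := fun a => ⟨rfl, a.idx, le_rfl, le_rfl, a.mem, rfl⟩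
      symm := fun {a b} ⟨e, r, h, h', hm, hr⟩ => ⟨e.symm, r, h', h, e ▸ hm, hr.symm⟩
      trans := by
        rintro a b c ⟨e, r, h, h', hm, hr⟩ ⟨e', r', k, k', km, kr⟩
        obtain ⟨s, hs, hs', hms⟩ := S.directed hm (e ▸ km)
        refine ⟨e.trans e', s, hs.trans h, hs'.trans k', hms, ?_⟩
        rw [← S.res_res hs h, hr, S.res_res, ← S.res_res hs' k', ← kr, S.res_res] }

/-- The total space of germs. -/
def Total : Type _ := Quotient S.germSetoid

/-- The germ at `x` of an element of `A p`. -/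
def germ (p : P) (x : X) (hx : x ∈ S.base p) (a : S.A p) : S.Total :=
  Quotient.mk _ ⟨p, x, hx, a⟩

/-- The projection to the base. -/
def proj : S.Total → X := Quotient.lift PreGerm.pt fun _ _ h => h.1

@[simp]
theorem proj_germ (p : P) (x : X) (hx : x ∈ S.base p) (a : S.A p) : S.proj (S.germ p x hx a) = x :=
  rfl

theorem exists_eq_germ (e : S.Total) : ∃ p hx a, e = S.germ p (S.proj e) hx a := by
  induction e using Quotient.inductionOn with
  | h e => exact ⟨e.idx, e.mem, e.val, rfl⟩

variable {S}

theorem germ_eq_iff {p q : P} {x : X} {hx : x ∈ S.base p} {hx' : x ∈ S.base q} {a : S.A p}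
    {b : S.A q} : S.germ p x hx a = S.germ q x hx' b ↔
      ∃ r, ∃ (h : r ≤ p) (h' : r ≤ q), x ∈ S.base r ∧ S.res h a = S.res h' b :=
  Quotient.eq.trans ⟨fun h => h.2, fun h => ⟨rfl, h⟩⟩

theorem germ_injective {p : P} {x : X} (hx : x ∈ S.base p) : Function.Injective (S.germ p x hx) := by
  intro a b h
  obtain ⟨r, h, _, _, hr⟩ := germ_eq_iff.mp h
  exact (S.bijective_res h).1 hr

theorem germ_res {p q : P} (h : p ≤ q) {x : X} (hx : x ∈ S.base p) (hx' : x ∈ S.base q)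
    (a : S.A q) : S.germ p x hx (S.res h a) = S.germ q x hx' a :=
  germ_eq_iff.mpr ⟨p, le_rfl, h, hx, S.res_res _ _ _⟩

theorem exists_germ_eq {p : P} {x : X} (hx : x ∈ S.base p) (e : S.Total) (he : S.proj e = x) :
    ∃ a, S.germ p x hx a = e := by
  subst he
  obtain ⟨q, hq, b, hb⟩ := S.exists_eq_germ e
  obtain ⟨r, h, h', hr⟩ := S.directed hx hq
  obtain ⟨a, ha⟩ := (S.bijective_res h).2 (S.res h' b)
  exact ⟨a, (germ_eq_iff.mpr ⟨r, h, h', hr, ha⟩).trans hb.symm⟩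

variable (S)

/-- The étale topology on the total space. -/
instance : TopologicalSpace S.Total where
  IsOpen W := ∀ p (a : S.A p), IsOpen {x | ∃ hx, S.germ p x hx a ∈ W}
  isOpen_univ p a := by
    convert S.isOpen_base p using 1
    ext x; simp
  isOpen_inter W W' h h' p a := by
    convert (h p a).inter (h' p a) using 1
    ext x
    exact ⟨fun ⟨hx, k⟩ => ⟨⟨hx, k.1⟩, ⟨hx, k.2⟩⟩, fun ⟨⟨hx, k⟩, ⟨_, k'⟩⟩ => ⟨hx, k, k'⟩⟩
  isOpen_sUnion 𝒲 h p a := by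
    have : {x | ∃ hx, S.germ p x hx a ∈ ⋃₀ 𝒲} =
        ⋃ W ∈ 𝒲, {x | ∃ hx, S.germ p x hx a ∈ W} := by
      ext x
      simp only [Set.mem_sUnion, Set.mem_ofPred_eq, Set.mem_iUnion]
      exact ⟨fun ⟨hx, W, hW, k⟩ => ⟨W, hW, hx, k⟩, fun ⟨W, hW, hx, k⟩ => ⟨hx, W, hW, k⟩⟩
    rw [this]
    exact isOpen_biUnion fun W hW => h W hW p a

variable {S}

theorem isOpen_total_iff {W : Set S.Total} :
    IsOpen W ↔ ∀ p (a : S.A p), IsOpen {x | ∃ hx, S.germ p x hx a ∈ W} := Iff.rfl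

/-- Two germs that agree at a point agree on a common refinement, hence at all nearby points. -/
theorem isOpen_germs {p : P} (a : S.A p) {W : Set X} (hW : IsOpen W) :
    IsOpen {e | ∃ x hx, x ∈ W ∧ S.germ p x hx a = e} := by
  rw [isOpen_total_iff]
  intro q b
  rw [isOpen_iff_mem_nhds]
  rintro x ⟨hx, y, hy, hyW, h⟩
  obtain rfl : y = x := congrArg S.proj h
  obtain ⟨r, hrp, hrq, hyr, e⟩ := germ_eq_iff.mp h
  filter_upwards [(S.isOpen_base r).mem_nhds hyr, (S.isOpen_base q).mem_nhds hx,
    (S.isOpen_base p).mem_nhds hy, hW.mem_nhds hyW] with z hzr hzq hzp hzW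
  exact ⟨hzq, z, hzp, hzW, germ_eq_iff.mpr ⟨r, hrp, hrq, hzr, e⟩⟩

theorem continuous_proj : Continuous S.proj := by
  refine continuous_def.mpr fun W hW => isOpen_total_iff.mpr fun p a => ?_
  convert (S.isOpen_base p).inter hW using 1
  ext x
  exact ⟨fun ⟨hx, k⟩ => ⟨hx, k⟩, fun ⟨hx, k⟩ => ⟨hx, k⟩⟩

theorem eventually_eq_germ {Y : Type*} [TopologicalSpace Y] {f : Y → S.Total} (hf : Continuous f)
    {g : Y → X} (hg : ∀ y, S.proj (f y) = g y) {y : Y} {p : P} {hx : g y ∈ S.base p} {a : S.A p}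
    (h : f y = S.germ p (g y) hx a) : ∀ᶠ z in nhds y, ∃ hz, f z = S.germ p (g z) hz a := by
  have ho := (isOpen_germs a isOpen_univ).preimage hf
  filter_upwards [ho.mem_nhds ⟨_, hx, Set.mem_univ _, h.symm⟩] with z hz
  obtain ⟨x, hx, -, e⟩ := hz
  obtain rfl : x = g z := (congrArg S.proj e).trans (hg z)
  exact ⟨hx, e.symm⟩

theorem continuous_of_eventually_eq_germ {Y : Type*} [TopologicalSpace Y] {f : Y → S.Total}
    {g : Y → X} (hg : Continuous g)
    (h : ∀ y, ∃ p, ∃ a : S.A p, ∀ᶠ z in nhds y, ∃ hz, f z = S.germ p (g z) hz a) :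
    Continuous f := by
  rw [continuous_iff_continuousAt]
  intro y
  obtain ⟨p, a, hpa⟩ := h y
  rw [continuousAt_def]
  intro W hW
  obtain ⟨W', hWW', hW', hy⟩ := mem_nhds_iff.mp hW
  obtain ⟨hyp, e⟩ := hpa.self_of_nhds
  have ho := (isOpen_total_iff.mp hW' p a).preimage hg
  filter_upwards [hpa, ho.mem_nhds ⟨hyp, e ▸ hy⟩] with z hz hz'
  obtain ⟨hz, e⟩ := hz
  obtain ⟨_, hz'⟩ := hz'
  rw [Set.mem_preimage, e]
  exact hWW' hz'

/-- Bijectivity of the restriction maps identifies the fibre over every point of `base p` with `A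
p`. Thus `base p` is evenly covered, with discrete fibre `A p`. -/
theorem isCoveringMap_proj : IsCoveringMap S.proj := by
  intro x
  obtain ⟨p, hx⟩ := S.cover x
  let _ : TopologicalSpace (S.A p) := ⊥
  have : DiscreteTopology (S.A p) := ⟨rfl⟩
  refine IsEvenlyCovered.to_isEvenlyCovered_preimage (I := S.A p)
    ⟨inferInstance, S.base p, hx, S.isOpen_base p, (S.isOpen_base p).preimage continuous_proj, ?_⟩
  choose σ hσ using fun e : S.proj ⁻¹' S.base p => exists_germ_eq e.2 e.1 rfl
  let H : S.base p × S.A p ≃ S.proj ⁻¹' S.base p :=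
    { toFun := fun y => ⟨S.germ p y.1.1 y.1.2 y.2, y.1.2⟩
      invFun := fun e => (⟨S.proj e.1, e.2⟩, σ e)
      left_inv := fun y => Prod.ext rfl (germ_injective y.1.2 (hσ ⟨S.germ p y.1.1 y.1.2 y.2, y.1.2⟩))
      right_inv := fun e => Subtype.ext (hσ e) }
  have hc : Continuous H := by
    refine Continuous.subtype_mk (continuous_of_eventually_eq_germ
      (g := fun y : S.base p × S.A p => (y.1 : X)) (by fun_prop) ?_) _
    intro y
    refine ⟨p, y.2, ?_⟩
    have : ∀ᶠ z : S.base p × S.A p in nhds y, y.2 = z.2 :=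
      (continuous_snd.tendsto y).eventually (mem_nhds_discrete.mpr rfl)
    filter_upwards [this] with z hz
    exact ⟨z.1.2, by rw [hz]⟩
  have hopen : IsOpenMap H := by
    intro W hW
    rw [isOpen_iff_mem_nhds]
    rintro _ ⟨⟨y, a⟩, hy, rfl⟩
    have h1 : IsOpen {z : X | ∃ hz : z ∈ S.base p, ((⟨z, hz⟩ : S.base p), a) ∈ W} := by
      have h2 : IsOpen {z : S.base p | (z, a) ∈ W} := hW.preimage (by fun_prop)
      convert (S.isOpen_base p).isOpenMap_subtype_val _ h2 using 1
      ext z; simp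
    have h3 := (isOpen_germs a h1).preimage
      (continuous_subtype_val (p := fun e => e ∈ S.proj ⁻¹' S.base p))
    refine Filter.mem_of_superset (h3.mem_nhds ?_) ?_
    · exact ⟨y.1, y.2, ⟨y.2, hy⟩, rfl⟩
    · rintro e ⟨z, hz, ⟨_, hzW⟩, he⟩
      exact ⟨(⟨z, hz⟩, a), hzW, Subtype.ext he⟩
  exact ⟨(H.toHomeomorphOfContinuousOpen hc hopen).symm, fun e => rfl⟩

/-- A continuous family of germs over a preconnected space mapping into `base p` is given by a
single element of `A p`. -/
theorem eq_germ_of_preconnected {Y : Type*} [TopologicalSpace Y] [PreconnectedSpace Y]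
    {f : Y → S.Total} (hf : Continuous f) {g : Y → X} (hg : ∀ y, S.proj (f y) = g y) {p : P}
    (hp : ∀ y, g y ∈ S.base p) {a : S.A p} {y₀ : Y} (h : f y₀ = S.germ p (g y₀) (hp y₀) a)
    (y : Y) : f y = S.germ p (g y) (hp y) a := by
  have hgc : Continuous g := (continuous_proj.comp hf).congr hg
  have hc : Continuous fun y => S.germ p (g y) (hp y) a :=
    continuous_of_eventually_eq_germ hgc
      fun y => ⟨p, a, Filter.Eventually.of_forall fun z => ⟨hp z, rfl⟩⟩
  exact congrFun (isCoveringMap_proj.eq_of_comp_eq hf hc (funext hg) y₀ h) y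

end LocalSystem

/-! ### Components of unions of balls -/

section Components

variable {n : ℕ} {M : Type u} [TopologicalSpace M] [ChartedSpace (EuclideanSpace ℝ (Fin n)) M]

theorem IsBall.isConnected {U : Opens M} (hU : IsBall n U) : IsConnected (U : Set M) := by
  obtain ⟨e⟩ := hU.nonempty_diffeo
  have : (U : Set M) = Set.range fun x => (e x : M) := by
    ext y
    constructor
    · intro hy
      exact ⟨e.symm ⟨y, hy⟩, by simp⟩
    · rintro ⟨x, rfl⟩
      exact (e x).2
  rw [this]
  exact isConnected_range (continuous_subtype_val.comp e.continuous)

theorem eq_of_mem_of_mem {ι : Type*} {T : ι → Opens M}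
    (hT : Pairwise fun i j => Disjoint (T i) (T j)) {x : M} {i j : ι} (hi : x ∈ T i)
    (hj : x ∈ T j) : i = j := by
  by_contra hij
  exact (Set.disjoint_left.mp (Opens.coe_disjoint.mpr (hT hij))) hi hj

theorem subset_of_isPreconnected {ι : Type*} {T : ι → Opens M}
    (hT : Pairwise fun i j => Disjoint (T i) (T j)) {S : Set M} (hS : IsPreconnected S)
    (h : S ⊆ (⨆ i, T i : Opens M)) {i : ι} {x : M} (hx : x ∈ S) (hi : x ∈ T i) :
    S ⊆ T i := by
  refine hS.subset_left_of_subset_union (v := ⋃ j ∈ {j | j ≠ i}, (T j : Set M)) (T i).isOpen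
    (isOpen_biUnion fun j _ => (T j).isOpen) ?_ ?_ ⟨x, hx, hi⟩
  · rw [Set.disjoint_left]
    intro y hy hy'
    simp only [Set.mem_iUnion] at hy'
    obtain ⟨j, hj, hyj⟩ := hy'
    exact hj (eq_of_mem_of_mem hT hyj hy)
  · intro y hy
    obtain ⟨j, hj⟩ := Opens.mem_iSup.mp (h hy)
    by_cases hij : j = i
    · exact Or.inl (hij ▸ hj)
    · exact Or.inr (Set.mem_biUnion hij hj)

theorem exists_componentMap {ι ι' : Type*} {T : ι → Opens M} {T' : ι' → Opens M}
    (hT : ∀ i, IsBall n (T i)) (hT' : Pairwise fun i j => Disjoint (T' i) (T' j))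
    (h : ⨆ i, T i ≤ ⨆ i, T' i) : ∃ π : ι → ι', ∀ i, T i ≤ T' (π i) := by
  have : ∀ i, ∃ j, T i ≤ T' j := by
    intro i
    obtain ⟨x, hx⟩ := (hT i).isConnected.nonempty
    have hi : T i ≤ ⨆ i, T' i := (le_iSup T i).trans h
    obtain ⟨j, hj⟩ := Opens.mem_iSup.mp (hi hx)
    exact ⟨j, subset_of_isPreconnected hT' (hT i).isConnected.isPreconnected hi hx hj⟩
  exact ⟨fun i => (this i).choose, fun i => (this i).choose_spec⟩

/-- A point of `T' j` is the end of the track of some `x` in a `T i`. The track is connected, so it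
stays in one component of the target, and it starts in `T' (π i)`; hence `π i = j`. -/
theorem surjective_of_isIsotopyEquiv {ι ι' : Type*} {T : ι → Opens M} {T' : ι' → Opens M}
    (hT' : ∀ i, IsBall n (T' i)) (hd : Pairwise fun i j => Disjoint (T' i) (T' j))
    (h : IsIsotopyEquiv n (⨆ i, T i) (⨆ i, T' i)) {π : ι → ι'} (hπ : ∀ i, T i ≤ T' (π i)) :
    Function.Surjective π := by
  obtain ⟨hle, L, hL⟩ := h
  intro j
  obtain ⟨y, hy⟩ := (hT' j).isConnected.nonempty
  have h1 := hL.one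
  rw [Set.range_eq_univ.mpr (fun x => ⟨x, rfl⟩ : Function.Surjective (Opens.inclusion
    (le_refl (⨆ i, T' i)))), Set.range_eq_univ] at h1
  obtain ⟨x, hx⟩ := h1 ⟨y, (le_iSup T' j) hy⟩
  obtain ⟨i, hi⟩ := Opens.mem_iSup.mp x.2
  refine ⟨i, eq_of_mem_of_mem (x := y) hd ?_ hy⟩
  have hS : IsPreconnected (Set.range fun t : unitInterval => (L (x, t) : M)) :=
    isPreconnected_range (continuous_subtype_val.comp (hL.continuous.comp (by fun_prop)))
  refine subset_of_isPreconnected hd hS ?_ (x := x) (i := π i) ⟨0, ?_⟩ (hπ i hi) ⟨1, ?_⟩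
  · rintro _ ⟨t, rfl⟩
    exact (L (x, t)).2
  · simp only [hL.zero]
  · simp only at hx ⊢
    rw [hx]

/-- An ordering of the components of a disjoint union can be adapted to any larger union to which
it is isotopy equivalent. -/
theorem exists_adapted_decomposition {B : Set (Opens M)} (hB : ∀ V ∈ B, IsBall n V) {k : ℕ}
    {U : Opens M} (hU : IsDisjUnion B k U) {T' : Fin k → Opens M} (hT' : ∀ i, IsBall n (T' i))
    (hd : Pairwise fun i j => Disjoint (T' i) (T' j)) (h : IsIsotopyEquiv n U (⨆ i, T' i)) :
    ∃ T : Fin k → Opens M, (∀ i, T i ∈ B) ∧ (Pairwise fun i j => Disjoint (T i) (T j)) ∧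
      U = ⨆ i, T i ∧ ∀ i, T i ≤ T' i := by
  obtain ⟨T, hT, hTd, rfl⟩ := hU
  obtain ⟨π, hπ⟩ := exists_componentMap (fun i => hB _ (hT i)) hd h.le
  have hs := surjective_of_isIsotopyEquiv hT' hd h hπ
  let e : Fin k ≃ Fin k := Equiv.ofBijective π ⟨Finite.injective_iff_surjective.mpr hs, hs⟩
  refine ⟨fun i => T (e.symm i), fun i => hT _, fun i j hij => hTd (e.symm.injective.ne hij),
    (Equiv.iSup_comp (g := T) e.symm).symm, fun i => ?_⟩
  have := hπ (e.symm i)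
  rwa [show π (e.symm i) = i from e.apply_symm_apply i] at this

theorem isIsotopyEquiv_of_bijective {ι ι' : Type*} {T : ι → Opens M} {T' : ι' → Opens M}
    (hT : ∀ i, IsBall n (T i)) (hT' : ∀ i, IsBall n (T' i))
    (hd : Pairwise fun i j => Disjoint (T' i) (T' j)) {π : ι → ι'} (hπ : ∀ i, T i ≤ T' (π i))
    (hb : Function.Bijective π) : IsIsotopyEquiv n (⨆ i, T i) (⨆ i, T' i) := by
  rw [← (Equiv.ofBijective π hb).iSup_comp (g := T')]
  exact isIsotopyEquiv_iSup_of_isBall hT (fun i => hT' _) (fun i j hij => hd (hb.1.ne hij)) hπ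

theorem isBallUnionLE_range {k : ℕ} {T : Fin k → Opens M} (hT : ∀ i, IsBall n (T i))
    (hd : Pairwise fun i j => Disjoint (T i) (T j)) {π : Fin k → Fin k}
    (hπ : ¬ Function.Surjective π) : IsBallUnionLE n ((k : ℤ) - 1) (⨆ i, T (π i)) := by
  classical
  let s := Finset.univ.image π
  have hs : s.card < k := by
    refine lt_of_lt_of_eq (Finset.card_lt_univ_of_notMem (x := (not_forall.mp hπ).choose) ?_)
      (Fintype.card_fin k)
    simpa [s] using (not_forall.mp hπ).choose_spec
  refine ⟨s.card, by omega, fun i => T (s.equivFin.symm i), fun i => hT _,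
    fun i j hij => hd (fun h => hij (s.equivFin.symm.injective (Subtype.ext h))), ?_⟩
  apply le_antisymm
  · refine iSup_le fun i => ?_
    refine le_iSup_of_le (s.equivFin ⟨π i, Finset.mem_image_of_mem _ (Finset.mem_univ i)⟩) ?_
    simp
  · refine iSup_le fun i => ?_
    obtain ⟨j, -, hj⟩ := Finset.mem_image.mp (s.equivFin.symm i).2
    exact le_iSup_of_le j (by rw [hj])

/-- The component map is a self-map of `Fin k`: either it is a bijection, or the components of `V`
that it hits form a union of fewer than `k` balls containing `U`. -/
theorem isIsotopyEquiv_or_factors {k : ℕ} {U V : Opens M} (hU : IsBallUnion n k U)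
    (hV : IsBallUnion n k V) (h : U ≤ V) : IsIsotopyEquiv n U V ∨
      ∃ W, U ≤ W ∧ W ≤ V ∧ IsBallUnionLE n ((k : ℤ) - 1) W := by
  obtain ⟨T, hT, hTd, rfl⟩ := hU
  obtain ⟨T', hT', hTd', rfl⟩ := hV
  obtain ⟨π, hπ⟩ := exists_componentMap hT hTd' h
  by_cases hs : Function.Surjective π
  · exact Or.inl (isIsotopyEquiv_of_bijective hT hT' hTd' hπ
      ⟨Finite.injective_iff_surjective.mpr hs, hs⟩)
  · exact Or.inr ⟨_, iSup_mono hπ, iSup_le fun i => le_iSup T' (π i),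
      isBallUnionLE_range hT' hTd' hs⟩

/-- The composite component map is onto `k` components. Since the middle term has at most `k`,
counting forces both factors to be bijective. With all three sets equal this also shows that the
number of balls is well defined. -/
theorem isIsotopyEquiv_factor {k j : ℕ} {U V W : Opens M} (hU : IsBallUnion n k U)
    (hV : IsBallUnion n j V) (hj : j ≤ k) (hW : IsBallUnion n k W) (hUV : U ≤ V) (hVW : V ≤ W)
    (h : IsIsotopyEquiv n U W) : j = k ∧ IsIsotopyEquiv n U V ∧ IsIsotopyEquiv n V W := by
  obtain ⟨T, hT, hTd, rfl⟩ := hU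
  obtain ⟨T', hT', hTd', rfl⟩ := hV
  obtain ⟨T'', hT'', hTd'', rfl⟩ := hW
  obtain ⟨a, ha⟩ := exists_componentMap hT hTd' hUV
  obtain ⟨b, hb⟩ := exists_componentMap hT' hTd'' hVW
  have hba : Function.Surjective (b ∘ a) :=
    surjective_of_isIsotopyEquiv hT'' hTd'' h fun i => (ha i).trans (hb (a i))
  have hbs := hba.of_comp
  have hkj : k ≤ j := by simpa using Fintype.card_le_of_surjective b hbs
  obtain rfl : j = k := le_antisymm hj hkj
  have hbb : Function.Bijective b := ⟨Finite.injective_iff_surjective.mpr hbs, hbs⟩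
  have hab : Function.Bijective a := by
    rw [← hbb.of_comp_iff']
    exact ⟨Finite.injective_iff_surjective.mpr hba, hba⟩
  exact ⟨rfl, isIsotopyEquiv_of_bijective hT hT' hTd' ha hab,
    isIsotopyEquiv_of_bijective hT' hT'' hTd'' hb hbb⟩

theorem IsBallUnion.not_isBallUnionLE {k : ℕ} {U : Opens M} (hU : IsBallUnion n k U) :
    ¬ IsBallUnionLE n ((k : ℤ) - 1) U := by
  rintro ⟨j, hj, hU'⟩
  have := (isIsotopyEquiv_factor hU hU' (by omega) hU le_rfl le_rfl (.refl U)).1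
  omega

theorem IsBallUnionLE.isBallUnion_or {k : ℕ} {U : Opens M} (hU : IsBallUnionLE n (k : ℤ) U) :
    IsBallUnion n k U ∨ IsBallUnionLE n ((k : ℤ) - 1) U := by
  obtain ⟨j, hj, hU⟩ := hU
  by_cases h : j = k
  · exact Or.inl (h ▸ hU)
  · exact Or.inr ⟨j, by omega, hU⟩

theorem IsBallUnionLE.mono {m m' : ℤ} {U : Opens M} (hU : IsBallUnionLE n m U) (h : m ≤ m') :
    IsBallUnionLE n m' U := by
  obtain ⟨j, hj, hU⟩ := hU
  exact ⟨j, hj.trans h, hU⟩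

theorem IsBallUnion.isBallUnionLE {k : ℕ} {U : Opens M} (hU : IsBallUnion n k U) :
    IsBallUnionLE n (k : ℤ) U := ⟨k, le_rfl, hU⟩

end Components

/-! ### Ordered configurations and the local system of a very good functor -/

section Configurations

/-- Ordered configurations of `k` distinct points. -/
abbrev Conf (k : ℕ) (Y : Type*) := {x : Fin k → Y // Function.Injective x}

/-- An injective map acts on configurations. -/
def Conf.map {k : ℕ} {Y Y' : Type*} (f : Y → Y') (hf : Function.Injective f) (x : Conf k Y) :
    Conf k Y' := ⟨fun i => f (x.1 i), hf.comp x.2⟩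

theorem Conf.continuous_map {k : ℕ} {Y Y' : Type*} [TopologicalSpace Y] [TopologicalSpace Y']
    {f : Y → Y'} (hf : Function.Injective f) (hc : Continuous f) :
    Continuous (Conf.map (k := k) f hf) :=
  Continuous.subtype_mk (continuous_pi fun i =>
    hc.comp ((continuous_apply i).comp continuous_subtype_val)) _

/-- Reordering the points of a configuration. -/
def Conf.perm {k : ℕ} {Y : Type*} (e : Fin k ≃ Fin k) (x : Conf k Y) : Conf k Y :=
  ⟨fun i => x.1 (e i), x.2.comp e.injective⟩

theorem Conf.continuous_perm {k : ℕ} {Y : Type*} [TopologicalSpace Y] (e : Fin k ≃ Fin k) :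
    Continuous (Conf.perm (Y := Y) e) :=
  Continuous.subtype_mk (f := fun x : Conf k Y => fun i => x.1 (e i))
    (continuous_pi fun i => (continuous_apply (e i)).comp continuous_subtype_val) _

variable (n : ℕ) {M : Type u} [TopologicalSpace M] [ChartedSpace (EuclideanSpace ℝ (Fin n)) M]

/-- An object of `𝓑⁽ᵏ⁾(M)` together with an ordering of its components. -/
structure Decomp (B : Set (Opens M)) (k : ℕ) where
  U : BasisSub n B k
  T : Fin k → Opens M
  mem : ∀ i, T i ∈ B
  disj : Pairwise fun i j => Disjoint (T i) (T j)
  eq : U.obj = ⨆ i, T i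

variable {n}

instance (B : Set (Opens M)) (k : ℕ) : Preorder (Decomp n B k) where
  le p q := ∀ i, p.T i ≤ q.T i
  le_refl p i := le_rfl
  le_trans p q r h h' i := (h i).trans (h' i)

namespace Decomp

variable {B : Set (Opens M)} {k : ℕ}

/-- The object with a given ordered family of components. -/
def mk' (T : Fin k → Opens M) (mem : ∀ i, T i ∈ B)
    (disj : Pairwise fun i j => Disjoint (T i) (T j)) : Decomp n B k where
  U := ⟨⨆ i, T i, T, mem, disj, rfl⟩
  T := T
  mem := mem
  disj := disj
  eq := rfl

/-- Reordering the components. -/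
def perm (e : Fin k ≃ Fin k) (p : Decomp n B k) : Decomp n B k where
  U := p.U
  T i := p.T (e i)
  mem _ := p.mem _
  disj _ _ hij := p.disj (e.injective.ne hij)
  eq := p.eq.trans (e.iSup_comp (g := p.T)).symm

omit [ChartedSpace (EuclideanSpace ℝ (Fin n)) M] in
theorem T_le (p : Decomp n B k) (i : Fin k) : p.T i ≤ p.U.obj := by
  rw [p.eq]; exact le_iSup p.T i

theorem U_le (hball : ∀ V ∈ B, IsBall n V) {p q : Decomp n B k} (h : p ≤ q) : p.U ≤ q.U := by
  change IsIsotopyEquiv n p.U.obj q.U.obj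
  rw [p.eq, q.eq]
  exact isIsotopyEquiv_iSup_of_isBall (fun i => hball _ (p.mem i)) (fun i => hball _ (q.mem i))
    q.disj h

/-- The configurations with the `i`-th point in the `i`-th component. -/
def base (p : Decomp n B k) : Set (Conf k M) := {x | ∀ i, x.1 i ∈ p.T i}

omit [ChartedSpace (EuclideanSpace ℝ (Fin n)) M] in
theorem isOpen_base (p : Decomp n B k) : IsOpen p.base := by
  have : p.base = ⋂ i, (fun x : Conf k M => x.1 i) ⁻¹' (p.T i : Set M) := by
    ext x; simp [base]
  rw [this]
  exact isOpen_iInter_of_finite fun i => (p.T i).isOpen.preimage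
    ((continuous_apply i).comp continuous_subtype_val)

theorem base_nonempty (hball : ∀ V ∈ B, IsBall n V) (p : Decomp n B k) : p.base.Nonempty := by
  choose x hx using fun i => (hball _ (p.mem i)).isConnected.nonempty
  refine ⟨⟨x, fun i j hij => ?_⟩, hx⟩
  exact eq_of_mem_of_mem p.disj (hx i) (hij ▸ hx j)

omit [ChartedSpace (EuclideanSpace ℝ (Fin n)) M] in
-- Intersecting `N i` with Hausdorff separating neighbourhoods of the points makes the chosen basis
-- balls disjoint.
theorem exists_mem_base (hbasis : Opens.IsBasis B) [T2Space M] (x : Conf k M)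
    (N : Fin k → Opens M) (hN : ∀ i, x.1 i ∈ N i) :
    ∃ p : Decomp n B k, x ∈ p.base ∧ ∀ i, p.T i ≤ N i := by
  obtain ⟨W, hW, hWd⟩ := (Set.finite_range x.1).t2_separation
  have h : ∀ i, ∃ V ∈ B, x.1 i ∈ V ∧ V ≤ N i ⊓ ⟨W (x.1 i), (hW _).2⟩ := fun i =>
    Opens.isBasis_iff_nbhd.mp hbasis ⟨hN i, (hW (x.1 i)).1⟩
  choose V hV hx hVW using h
  refine ⟨mk' V hV ?_, hx, fun i => (hVW i).trans inf_le_left⟩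
  intro i j hij
  rw [← Opens.coe_disjoint]
  refine (hWd (Set.mem_range_self i) (Set.mem_range_self j) (x.2.ne hij)).mono ?_ ?_
  · exact fun y hy => (hVW i hy).2
  · exact fun y hy => (hVW j hy).2

/-- Disjointness of the components makes distinctness of the points automatic, so `base` is a full
product of connected sets. -/
theorem base_isPreconnected (hball : ∀ V ∈ B, IsBall n V) (p : Decomp n B k) :
    IsPreconnected p.base := by
  have h1 : IsPreconnected (Set.univ.pi fun i => (p.T i : Set M)) :=
    isPreconnected_univ_pi fun i => (hball _ (p.mem i)).isConnected.isPreconnected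
  have h2 : Subtype.val '' p.base = Set.univ.pi fun i => (p.T i : Set M) := by
    ext x
    constructor
    · rintro ⟨x, hx, rfl⟩ i -
      exact hx i
    · intro hx
      refine ⟨⟨x, fun i j hij => ?_⟩, fun i => hx i trivial, rfl⟩
      exact eq_of_mem_of_mem p.disj (hx i trivial) (hij ▸ hx j trivial)
  rw [← h2] at h1
  exact Topology.IsInducing.subtypeVal.isPreconnected_image.mp h1

end Decomp

variable {C : Type v} [Category.{w} C] {B : Set (Opens M)} {k : ℕ}

theorem IsVeryGood.isIso_map {P : Opens M → Prop} {G : (IsoSub n P)ᵒᵖ ⥤ C}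
    (hG : IsVeryGood n (IsoSub.ι n P) G) {a b : (IsoSub n P)ᵒᵖ} (f : a ⟶ b) : IsIso (G.map f) :=
  hG f.unop (leOfHom f.unop)

/-- The local system of morphisms from a fixed object to the values of a very good functor. -/
def confSystem [T2Space M] (hbasis : Opens.IsBasis B) (hball : ∀ V ∈ B, IsBall n V)
    {G : (BasisSub n B k)ᵒᵖ ⥤ C} (hG : IsVeryGood n (IsoSub.ι n (IsDisjUnion B k)) G) (Z : C) :
    LocalSystem.{w} (Conf k M) (Decomp n B k) where
  base := Decomp.base
  isOpen_base := Decomp.isOpen_base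
  A p := Z ⟶ G.obj (op p.U)
  res h a := a ≫ G.map (homOfLE (Decomp.U_le hball h)).op
  res_res h h' a := by
    rw [Category.assoc, ← G.map_comp]
    rfl
  bijective_res {p q} h := by
    have := hG.isIso_map (homOfLE (Decomp.U_le hball h)).op
    constructor
    · intro a b hab
      exact (cancel_mono _).mp hab
    · intro b
      exact ⟨b ≫ inv (G.map (homOfLE (Decomp.U_le hball h)).op), by simp⟩
  directed {p q x} hp hq := by
    obtain ⟨r, hr, h⟩ := Decomp.exists_mem_base (n := n) hbasis x (fun i => p.T i ⊓ q.T i)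
      fun i => ⟨hp i, hq i⟩
    exact ⟨r, fun i => (h i).trans inf_le_left, fun i => (h i).trans inf_le_right, hr⟩
  cover x := by
    obtain ⟨p, hp, -⟩ := Decomp.exists_mem_base (n := n) hbasis x (fun _ => ⊤) fun _ => trivial
    exact ⟨p, hp⟩

end Configurations

/-! ### Compatible families over a cell are determined by one value -/

section SimplyConnected

variable {n : ℕ} {M : Type u} [TopologicalSpace M] [ChartedSpace (EuclideanSpace ℝ (Fin n)) M]
  {C : Type v} [Category.{w} C] {B : Set (Opens M)} {k : ℕ}

/-- A family of morphisms from `Z` to the values of `G` at the objects of `𝓑⁽ᵏ⁾(M)` which are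
isotopy equivalent to `V`. -/
abbrev LocalFamily (G : (BasisSub n B k)ᵒᵖ ⥤ C) (V : Opens M) (Z : C) :=
  ∀ U : BasisSub n B k, IsIsotopyEquiv n U.obj V → (Z ⟶ G.obj (op U))

/-- Compatibility of a family with restriction. -/
def LocalFamily.Compatible {G : (BasisSub n B k)ᵒᵖ ⥤ C} {V : Opens M} {Z : C}
    (t : LocalFamily G V Z) : Prop :=
  ∀ ⦃U U' : BasisSub n B k⦄ (h : U ≤ U') (hU : IsIsotopyEquiv n U.obj V)
    (hU' : IsIsotopyEquiv n U'.obj V), t U' hU' ≫ G.map (homOfLE h).op = t U hU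

/-- Supplies the connected and simply connected parameter space needed to compare and lift maps into
the covering. -/
theorem nonempty_homeomorph {T : Fin k → Opens M} (hT : ∀ i, IsBall n (T i))
    (hd : Pairwise fun i j => Disjoint (T i) (T j)) :
    Nonempty ((Fin k → EuclideanSpace ℝ (Fin n)) ≃ₜ {x : Conf k M // ∀ i, x.1 i ∈ T i}) := by
  have e := fun i => (hT i).nonempty_diffeo.some
  exact ⟨{
    toFun := fun d => ⟨⟨fun i => (e i (d i) : M), fun i j hij => eq_of_mem_of_mem hd (e i (d i)).2
      (by simp only at hij; rw [hij]; exact (e j (d j)).2)⟩, fun i => (e i (d i)).2⟩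
    invFun := fun x i => (e i).symm ⟨x.1.1 i, x.2 i⟩
    left_inv := fun d => by simp
    right_inv := fun x => Subtype.ext (Subtype.ext (by simp))
    continuous_toFun := Continuous.subtype_mk (Continuous.subtype_mk (continuous_pi fun i =>
      continuous_subtype_val.comp ((e i).continuous.comp (continuous_apply i))) _) _
    continuous_invFun := continuous_pi fun i => (e i).symm.continuous.comp
      (Continuous.subtype_mk ((continuous_apply i).comp
        (continuous_subtype_val.comp continuous_subtype_val)) _) }⟩

variable (hball : ∀ V ∈ B, IsBall n V) {T : Fin k → Opens M} (hT : ∀ i, IsBall n (T i))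
  (hd : Pairwise fun i j => Disjoint (T i) (T j))
include hball

include hT hd in
theorem Decomp.isIsotopyEquiv_iSup {p : Decomp n B k} (hp : ∀ i, p.T i ≤ T i) :
    IsIsotopyEquiv n p.U.obj (⨆ i, T i) := by
  rw [p.eq]
  exact isIsotopyEquiv_iSup_of_isBall (fun i => hball _ (p.mem i)) hT hd hp

variable [T2Space M] (hbasis : Opens.IsBasis B)
  {G : (BasisSub n B k)ᵒᵖ ⥤ C} (hG : IsVeryGood n (IsoSub.ι n (IsDisjUnion B k)) G) {Z : C}
include hbasis hG

include hT hd in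
-- A compatible family defines a continuous section of germs over the cell. Two lifts to a covering
-- of a connected space that agree at one point agree everywhere.
theorem LocalFamily.eq_of_eq {t t' : LocalFamily G (⨆ i, T i) Z} (ht : t.Compatible)
    (ht' : t'.Compatible) {U₀ : BasisSub n B k} (h₀ : IsIsotopyEquiv n U₀.obj (⨆ i, T i))
    (h : t U₀ h₀ = t' U₀ h₀) : t = t' := by
  let S := confSystem hbasis hball hG Z
  obtain ⟨Φ⟩ := nonempty_homeomorph hT hd
  obtain ⟨f, hfΦ⟩ : ∃ f : (Fin k → EuclideanSpace ℝ (Fin n)) → Conf k M, ∀ d, f d = (Φ d).1 :=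
    ⟨_, fun _ => rfl⟩
  have hf : Continuous f := (continuous_subtype_val.comp Φ.continuous).congr fun d => (hfΦ d).symm
  have hfT : ∀ x : Conf k M, (∀ i, x.1 i ∈ T i) → ∃ d, f d = x := fun x hx =>
    ⟨Φ.symm ⟨x, hx⟩, by simp [hfΦ]⟩
  have hiso : ∀ {p : Decomp n B k}, (∀ i, p.T i ≤ T i) → IsIsotopyEquiv n p.U.obj (⨆ i, T i) :=
    fun hp => Decomp.isIsotopyEquiv_iSup hball hT hd hp
  choose p hp hpT using fun d => Decomp.exists_mem_base (n := n) hbasis (f d) T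
    (by rw [hfΦ]; exact (Φ d).2)
  let σ : LocalFamily G (⨆ i, T i) Z → (Fin k → EuclideanSpace ℝ (Fin n)) → S.Total :=
    fun t d => S.germ (p d) (f d) (hp d) (t (p d).U (hiso (hpT d)))
  have hσ : ∀ {t : LocalFamily G (⨆ i, T i) Z}, t.Compatible → ∀ (d) (q : Decomp n B k)
      (hq : f d ∈ q.base) (hqT : ∀ i, q.T i ≤ T i),
      σ t d = S.germ q (f d) hq (t q.U (hiso hqT)) := by
    intro t ht d q hq hqT
    obtain ⟨r, h, h', hr⟩ := S.directed (hp d) hq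
    refine LocalSystem.germ_eq_iff.mpr ⟨r, h, h', hr, ?_⟩
    have hrT : ∀ i, r.T i ≤ T i := fun i => (h' i).trans (hqT i)
    exact (ht (Decomp.U_le hball h) (hiso hrT) _).trans
      (ht (Decomp.U_le hball h') (hiso hrT) _).symm
  have hσc : ∀ {t : LocalFamily G (⨆ i, T i) Z}, t.Compatible → Continuous (σ t) := by
    intro t ht
    refine LocalSystem.continuous_of_eventually_eq_germ hf fun d =>
      ⟨p d, t (p d).U (hiso (hpT d)), ?_⟩
    filter_upwards [((p d).isOpen_base.preimage hf).mem_nhds (hp d)] with d' hd'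
    exact ⟨hd', hσ ht d' (p d) hd' (hpT d)⟩
  -- Every object in the family can be ordered compatibly with `T`, so its value is read off from
  -- the section at a configuration in its components.
  have key : ∀ (U : BasisSub n B k) (hU : IsIsotopyEquiv n U.obj (⨆ i, T i)),
      ∃ (q : Decomp n B k) (d : _), q.U = U ∧ (∀ i, q.T i ≤ T i) ∧ f d ∈ q.base := by
    intro U hU
    obtain ⟨R, hR, hRd, hRU, hRT⟩ := exists_adapted_decomposition hball U.property hT hd hU
    let q : Decomp n B k := ⟨U, R, hR, hRd, hRU⟩
    obtain ⟨x, hx⟩ := q.base_nonempty hball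
    obtain ⟨d, hdx⟩ := hfT x fun i => hRT i (hx i)
    exact ⟨q, d, rfl, hRT, hdx ▸ hx⟩
  have heq : σ t = σ t' := by
    obtain ⟨q, d, rfl, hqT, hdq⟩ := key U₀ h₀
    refine LocalSystem.isCoveringMap_proj.eq_of_comp_eq (hσc ht) (hσc ht') rfl d ?_
    rw [hσ ht d q hdq hqT, hσ ht' d q hdq hqT, h]
  ext1 U
  ext1 hU
  obtain ⟨q, d, rfl, hqT, hdq⟩ := key U hU
  have := congrFun heq d
  rw [hσ ht d q hdq hqT, hσ ht' d q hdq hqT] at this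
  exact LocalSystem.germ_injective hdq this

include hT hd in
-- The cell is simply connected, so its inclusion lifts to the covering through the germ of `a`;
-- over the components of each `U` the lift is the germ of a single morphism.
theorem LocalFamily.exists_extension {U₀ : BasisSub n B k}
    (h₀ : IsIsotopyEquiv n U₀.obj (⨆ i, T i)) (a : Z ⟶ G.obj (op U₀)) :
    ∃ t : LocalFamily G (⨆ i, T i) Z, t.Compatible ∧ t U₀ h₀ = a := by
  let S := confSystem hbasis hball hG Z
  obtain ⟨Φ⟩ := nonempty_homeomorph hT hd
  obtain ⟨f, hfΦ⟩ : ∃ f : (Fin k → EuclideanSpace ℝ (Fin n)) → Conf k M, ∀ d, f d = (Φ d).1 :=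
    ⟨_, fun _ => rfl⟩
  have hf : Continuous f := (continuous_subtype_val.comp Φ.continuous).congr fun d => (hfΦ d).symm
  have hfT : ∀ x : Conf k M, (∀ i, x.1 i ∈ T i) → ∃ d, f d = x := fun x hx =>
    ⟨Φ.symm ⟨x, hx⟩, by simp [hfΦ]⟩
  have key : ∀ (U : BasisSub n B k) (hU : IsIsotopyEquiv n U.obj (⨆ i, T i)),
      ∃ (q : Decomp n B k), q.U = U ∧ (∀ i, q.T i ≤ T i) := by
    intro U hU
    obtain ⟨R, hR, hRd, hRU, hRT⟩ := exists_adapted_decomposition hball U.property hT hd hU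
    exact ⟨⟨U, R, hR, hRd, hRU⟩, rfl, hRT⟩
  have hne : ∀ q : Decomp n B k, (∀ i, q.T i ≤ T i) → ∃ d, f d ∈ q.base := by
    intro q hqT
    obtain ⟨x, hx⟩ := q.base_nonempty hball
    obtain ⟨d, hdx⟩ := hfT x fun i => hqT i (hx i)
    exact ⟨d, hdx ▸ hx⟩
  obtain ⟨q₀, rfl, hq₀T⟩ := key U₀ h₀
  obtain ⟨d₀, hd₀⟩ := hne q₀ hq₀T
  obtain ⟨F, ⟨hF₀, hFf⟩, -⟩ := LocalSystem.isCoveringMap_proj.existsUnique_continuousMap_lifts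
    (⟨f, hf⟩ : C(_, _)) d₀ (S.germ q₀ (f d₀) hd₀ a) rfl
  have hFf : ∀ d, S.proj (F d) = f d := fun d => congrFun hFf d
  have hex : ∀ q : Decomp n B k, (∀ i, q.T i ≤ T i) → ∃ b : Z ⟶ G.obj (op q.U),
      ∀ d (hdq : f d ∈ q.base), F d = S.germ q (f d) hdq b := by
    intro q hqT
    obtain ⟨d₁, hd₁⟩ := hne q hqT
    obtain ⟨b, hb⟩ := LocalSystem.exists_germ_eq (S := S) (p := q) hd₁ (F d₁) (hFf d₁)
    refine ⟨b, fun d hdq => ?_⟩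
    have : PreconnectedSpace q.base := Subtype.preconnectedSpace (q.base_isPreconnected hball)
    have hqb : ∀ y ∈ q.base, ∀ i, y.1 i ∈ T i := fun y hy i => hqT i (hy i)
    let g : q.base → (Fin k → EuclideanSpace ℝ (Fin n)) := fun y => Φ.symm ⟨y.1, hqb y.1 y.2⟩
    have hg : Continuous g := Φ.symm.continuous.comp (continuous_subtype_val.subtype_mk _)
    have hgd : ∀ (d) (hdq : f d ∈ q.base), g ⟨f d, hdq⟩ = d := fun d hdq => by
      simp only [g, hfΦ, Subtype.coe_eta, Homeomorph.symm_apply_apply]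
    have hfg : ∀ y, f (g y) = y.1 := fun y => by simp [hfΦ, g]
    have := LocalSystem.eq_germ_of_preconnected (S := S) (F.continuous.comp hg) (g := Subtype.val)
      (fun y => by rw [Function.comp_apply, hFf, hfg]) (p := q) (fun y => y.2) (a := b)
      (y₀ := ⟨f d₁, hd₁⟩) (by rw [Function.comp_apply, hgd, hb]) ⟨f d, hdq⟩
    rwa [Function.comp_apply, hgd] at this
  choose s hs using hex
  choose q hqU hqT using key
  have hs_res : ∀ (p q : Decomp n B k) (hp : ∀ i, p.T i ≤ T i) (hq : ∀ i, q.T i ≤ T i)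
      (h : p.U ≤ q.U), s q hq ≫ G.map (homOfLE h).op = s p hp := by
    intro p q hp hq h
    -- Both orderings are subordinate to the disjoint family `T`, so the inclusion of unions
    -- preserves indices.
    have hpq : p ≤ q := by
      intro i x hx
      have hx' : x ∈ q.U.obj := h.le (p.T_le i hx)
      rw [q.eq] at hx'
      obtain ⟨j, hj⟩ := Opens.mem_iSup.mp hx'
      rwa [eq_of_mem_of_mem hd (hp i hx) (hq j hj)]
    obtain ⟨d, hd⟩ := hne p hp
    have hd' : f d ∈ q.base := fun i => hpq i (hd i)
    refine LocalSystem.germ_injective (S := S) (p := p) hd ?_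
    rw [← hs p hp d hd, hs q hq d hd']
    exact LocalSystem.germ_res (S := S) hpq hd hd' (s q hq)
  have hs₀ : s q₀ hq₀T = a := by
    refine LocalSystem.germ_injective (S := S) (p := q₀) hd₀ ?_
    rw [← hs q₀ hq₀T d₀ hd₀, hF₀]
  refine ⟨fun U hU => s (q U hU) (hqT U hU) ≫ G.map (homOfLE (hqU U hU).ge).op, ?_, ?_⟩
  · intro U U' h hU hU'
    dsimp only
    rw [Category.assoc, ← G.map_comp, ← hs_res (q U hU) (q U' hU') (hqT U hU) (hqT U' hU')
      ((hqU U hU).le.trans (h.trans (hqU U' hU').ge)), Category.assoc, ← G.map_comp]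
    rfl
  · dsimp only
    rw [hs_res _ _ hq₀T, hs₀]

/-- The limit computing the right Kan extension at `V` of a very good functor on `𝓑⁽ᵏ⁾(M)` maps
isomorphically to the value at each object of `𝓑⁽ᵏ⁾(M)` isotopy equivalent to `V`. -/
theorem isIso_π_app {V : (BallSub n M k)ᵒᵖ}
    {c : Cone (StructuredArrow.proj V (basisIncl n hball k).op ⋙ G)} (hc : IsLimit c)
    (j : StructuredArrow V (basisIncl n hball k).op) : IsIso (c.π.app j) := by
  obtain ⟨⟨V, T, hT, hd, rfl⟩⟩ := V
  let V : (BallSub n M k)ᵒᵖ := op ⟨_, T, hT, hd, rfl⟩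
  let arr : ∀ U : BasisSub n B k, IsIsotopyEquiv n U.obj (⨆ i, T i) →
      StructuredArrow V (basisIncl n hball k).op := fun U hU =>
    StructuredArrow.mk (Y := op U) (homOfLE hU : (basisIncl n hball k).obj U ⟶ V.unop).op
  have harr : ∀ j : StructuredArrow V (basisIncl n hball k).op,
      j = arr j.right.unop (leOfHom j.hom.unop) := fun _ => rfl
  -- By Yoneda: morphisms from `Z` to the limit are compatible families, and the leg at `j`
  -- evaluates such a family at one object.
  rw [isIso_iff_yoneda_map_bijective]
  intro Z
  let t : (Z ⟶ c.pt) → LocalFamily G (⨆ i, T i) Z := fun x U hU => x ≫ c.π.app (arr U hU)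
  have ht : ∀ x, (t x).Compatible := by
    intro x U U' h hU hU'
    have := c.w (StructuredArrow.homMk (homOfLE h).op rfl : arr U' hU' ⟶ arr U hU)
    exact (Category.assoc _ _ _).trans (congrArg (x ≫ ·) this)
  constructor
  · intro x x' h
    have := LocalFamily.eq_of_eq hball hT hd hbasis hG (ht x) (ht x')
      (leOfHom j.hom.unop) h
    refine hc.hom_ext fun j => ?_
    exact congrFun (congrFun this j.right.unop) (leOfHom j.hom.unop)
  · intro a
    obtain ⟨s, hs, hsa⟩ := LocalFamily.exists_extension hball hT hd hbasis hG
      (leOfHom j.hom.unop) a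
    let c' : Cone (StructuredArrow.proj V (basisIncl n hball k).op ⋙ G) :=
      { pt := Z
        π :=
          { app := fun j => s j.right.unop (leOfHom j.hom.unop)
            naturality := fun j j' f => by
              exact (Category.id_comp _).trans (hs (leOfHom f.right.unop) (leOfHom j'.hom.unop)
                (leOfHom j.hom.unop)).symm } }
    exact ⟨hc.lift c', (hc.fac c' j).trans hsa⟩

end SimplyConnected

/-! ### Surjective smooth embeddings are diffeomorphisms; transport of balls -/

section Diffeo

variable {n : ℕ}

/-- The inverse is continuous by the embedding property and smooth by the inverse function theorem:
in equal finite dimensions an injective differential is invertible. -/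
theorem IsSmoothEmb.exists_diffeo {X Y : Type*}
    [TopologicalSpace X] [ChartedSpace (EuclideanSpace ℝ (Fin n)) X]
    [TopologicalSpace Y] [ChartedSpace (EuclideanSpace ℝ (Fin n)) Y] {f : X → Y}
    (hf : IsSmoothEmb (n := n) f) (hs : Function.Surjective f) :
    ∃ e : X ≃ₘ^∞⟮𝓡 n, 𝓡 n⟯ Y, ⇑e = f := by
  let h : X ≃ₜ Y := hf.isEmbedding.toHomeomorphOfSurjective hs
  have hh : ⇑h = f := rfl
  refine ⟨{ toEquiv := h.toEquiv, contMDiff_toFun := hf.contMDiff, contMDiff_invFun := ?_ }, rfl⟩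
  intro y
  obtain ⟨x, rfl⟩ := h.surjective y
  have hfx := (contMDiffAt_iff.mp (hf.contMDiff x)).2
  have hd := hf.injective_mfderiv x
  have hmf := (hf.contMDiff.mdifferentiable (by simp) x).mfderiv
  -- `h` read in the preferred charts at `x` and `h x`.
  let Φ : OpenPartialHomeomorph (EuclideanSpace ℝ (Fin n)) (EuclideanSpace ℝ (Fin n)) :=
    ((chartAt (EuclideanSpace ℝ (Fin n)) x).symm.trans h.toOpenPartialHomeomorph).trans
      (chartAt (EuclideanSpace ℝ (Fin n)) (h x))
  have hx : Φ.symm (chartAt (EuclideanSpace ℝ (Fin n)) (h x) (h x)) =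
      chartAt (EuclideanSpace ℝ (Fin n)) x x := by simp [Φ]
  have hΦ : ContDiffAt ℝ ∞ Φ (chartAt (EuclideanSpace ℝ (Fin n)) x x) := by
    rw [← contDiffWithinAt_univ]
    have hr : Set.range (𝓡 n) = Set.univ := Set.range_id
    rw [hr] at hfx
    exact hfx
  have hdΦ : Function.Injective (fderiv ℝ Φ (chartAt (EuclideanSpace ℝ (Fin n)) x x)) := by
    rw [← fderivWithin_univ]
    have hr : Set.range (𝓡 n) = Set.univ := Set.range_id
    rw [hr] at hmf
    intro a b hab
    apply hd
    rw [hmf]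
    exact hab
  let A : EuclideanSpace ℝ (Fin n) ≃L[ℝ] EuclideanSpace ℝ (Fin n) :=
    (LinearEquiv.ofInjectiveEndo _ hdΦ).toContinuousLinearEquiv
  have hA : HasFDerivAt Φ (A : EuclideanSpace ℝ (Fin n) →L[ℝ] EuclideanSpace ℝ (Fin n))
      (chartAt (EuclideanSpace ℝ (Fin n)) x x) := by
    have hAe : (A : EuclideanSpace ℝ (Fin n) →L[ℝ] EuclideanSpace ℝ (Fin n)) =
        fderiv ℝ Φ (chartAt (EuclideanSpace ℝ (Fin n)) x x) := by ext1 v; rfl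
    rw [hAe]
    exact (hΦ.differentiableAt (by simp)).hasFDerivAt
  have key := Φ.contDiffAt_symm (a := chartAt (EuclideanSpace ℝ (Fin n)) (h x) (h x))
    (by simp [Φ]) (f₀' := A) (by rw [hx]; exact hA) (by rw [hx]; exact hΦ)
  have hx' : h.toEquiv.symm (h x) = x := h.symm_apply_apply x
  refine contMDiffAt_iff.mpr ⟨h.symm.continuous.continuousAt, ?_⟩
  rw [hx']
  exact key.contDiffWithinAt

variable {M : Type u} [TopologicalSpace M] [ChartedSpace (EuclideanSpace ℝ (Fin n)) M]

/-- The open subset of `U` corresponding to `V ∩ W` under a diffeomorphism `U ≃ W`. -/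
def pullback {U W : Opens M} (e : U ≃ₘ^∞⟮𝓡 n, 𝓡 n⟯ W) (V : Opens M) : Opens M :=
  ⟨Subtype.val '' {x : U | (e x : M) ∈ V}, U.isOpen.isOpenMap_subtype_val _
    (V.isOpen.preimage (continuous_subtype_val.comp e.continuous))⟩

variable {U W V : Opens M} (e : U ≃ₘ^∞⟮𝓡 n, 𝓡 n⟯ W)

theorem mem_pullback {x : U} : (x : M) ∈ pullback e V ↔ (e x : M) ∈ V :=
  ⟨fun ⟨y, hy, h⟩ => by rwa [← Subtype.ext h], fun h => ⟨x, h, rfl⟩⟩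

theorem pullback_le : pullback e V ≤ U := by
  rintro _ ⟨x, -, rfl⟩
  exact x.2

theorem IsBall.pullback (hV : IsBall n V) (hVW : V ≤ W) : IsBall n (pullback e V) := by
  obtain ⟨φ⟩ := hV
  have h1 : ∀ x : VeryGood.pullback e V, (e (Opens.inclusion (pullback_le e) x) : M) ∈ V :=
    fun x => (mem_pullback e).mp x.2
  have h2 : ∀ y : V, (e.symm (Opens.inclusion hVW y) : M) ∈ VeryGood.pullback e V := fun y =>
    (mem_pullback e).mpr (by rw [e.apply_symm_apply]; exact y.2)
  have h3 : ∀ x, (e.symm (Opens.inclusion hVW ⟨e (Opens.inclusion (pullback_le e) x), h1 x⟩) : M)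
      = x := fun x => congrArg Subtype.val (e.symm_apply_apply (Opens.inclusion (pullback_le e) x))
  have h4 : ∀ y, (e (Opens.inclusion (pullback_le e) ⟨e.symm (Opens.inclusion hVW y), h2 y⟩) : M)
      = y := fun y => congrArg Subtype.val (e.apply_symm_apply (Opens.inclusion hVW y))
  exact ⟨Diffeomorph.trans {
    toFun := fun x => ⟨e (Opens.inclusion (pullback_le e) x), h1 x⟩
    invFun := fun y => ⟨e.symm (Opens.inclusion hVW y), h2 y⟩
    left_inv := fun x => Subtype.ext (h3 x)
    right_inv := fun y => Subtype.ext (h4 y)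
    contMDiff_toFun := by
      rw [← ContMDiff.subtypeVal_comp_iff]
      have := (contMDiff_subtype_val (I := 𝓡 n) (n := ∞) (U := W)).comp
        (e.contMDiff.comp (contMDiff_inclusion (pullback_le e (V := V))))
      exact this
    contMDiff_invFun := by
      rw [← ContMDiff.subtypeVal_comp_iff]
      have := (contMDiff_subtype_val (I := 𝓡 n) (n := ∞) (U := U)).comp
        (e.symm.contMDiff.comp (contMDiff_inclusion hVW))
      exact this } φ⟩

theorem IsBallUnionLE.pullback {m : ℤ} (hV : IsBallUnionLE n m V) (hVW : V ≤ W) :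
    IsBallUnionLE n m (pullback e V) := by
  obtain ⟨j, hj, T, hT, hd, rfl⟩ := hV
  refine ⟨j, hj, fun i => VeryGood.pullback e (T i),
    fun i => (hT i).pullback e ((le_iSup T i).trans hVW), ?_, ?_⟩
  · intro i i' hii
    rw [← Opens.coe_disjoint, Set.disjoint_left]
    rintro _ ⟨x, hx, rfl⟩ hx'
    exact hii (eq_of_mem_of_mem hd hx ((mem_pullback e).mp hx'))
  · ext x
    simp only [Opens.coe_iSup, Set.mem_iUnion, SetLike.mem_coe]
    constructor
    · rintro ⟨y, hy, rfl⟩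
      obtain ⟨i, hi⟩ := Opens.mem_iSup.mp hy
      exact ⟨i, (mem_pullback e).mpr hi⟩
    · rintro ⟨i, y, hy, rfl⟩
      exact (mem_pullback e).mpr (le_iSup T i hy)

end Diffeo

/-! ### Configurations in an open subset -/

section ConfOpens

variable {k : ℕ} {M : Type u} [TopologicalSpace M]

/-- The inclusion of configurations in an open subset. -/
abbrev Conf.incl (U : Opens M) : Conf k U → Conf k M := Conf.map Subtype.val Subtype.val_injective

theorem Conf.continuous_incl (U : Opens M) : Continuous (Conf.incl (k := k) U) :=
  Conf.continuous_map _ continuous_subtype_val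

/-- A configuration of points of `U`, as a configuration in `U`. -/
def Conf.lift {U : Opens M} (x : Conf k M) (hx : ∀ i, x.1 i ∈ U) : Conf k U :=
  ⟨fun i => ⟨x.1 i, hx i⟩, fun _ _ hij => x.2 (congrArg Subtype.val hij)⟩

theorem Conf.continuous_lift {U : Opens M} {Y : Type*} [TopologicalSpace Y] {f : Y → Conf k M}
    (hf : Continuous f) (h : ∀ y i, (f y).1 i ∈ U) :
    Continuous fun y => Conf.lift (f y) (h y) :=
  Continuous.subtype_mk (continuous_pi fun i => Continuous.subtype_mk
    ((continuous_apply i).comp (continuous_subtype_val.comp hf)) _) _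

end ConfOpens

/-! ### Morphisms into `H U` as equivariant sections over `Conf k U` -/

section Sections

variable {n : ℕ} {M : Type u} [TopologicalSpace M] [ChartedSpace (EuclideanSpace ℝ (Fin n)) M]
  [T2Space M] {C : Type v} [Category.{w} C] {k : ℕ}
  (hbasis : Opens.IsBasis {V : Opens M | IsBall n V}) {H : (Opens M)ᵒᵖ ⥤ C}
  (hH : IsVeryGood n (IsoSub.ι n (IsDisjUnion {V : Opens M | IsBall n V} k))
    ((IsoSub.ι n (IsDisjUnion {V : Opens M | IsBall n V} k)).op ⋙ H)) (Z : C)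

/-- The local system on the configuration space given by morphisms from `Z` to the values of `H`. -/
abbrev ballSystem : LocalSystem.{w} (Conf k M) (Decomp n {V : Opens M | IsBall n V} k) :=
  confSystem hbasis (fun _ h => h) hH Z

variable {Z}

/-- The germ at a configuration of a morphism `Z ⟶ H V`. -/
def germAt (p : Decomp n {V : Opens M | IsBall n V} k) {x : Conf k M} (hx : x ∈ p.base)
    {V : Opens M} (h : p.U.obj ≤ V) (s : Z ⟶ H.obj (op V)) : (ballSystem hbasis hH Z).Total :=
  (ballSystem hbasis hH Z).germ p x hx (s ≫ H.map (homOfLE h).op)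

variable {p q : Decomp n {V : Opens M | IsBall n V} k} {x : Conf k M} {V V' : Opens M}

theorem germAt_res (hx : x ∈ p.base) (h : p.U.obj ≤ V) (h' : V ≤ V') (s : Z ⟶ H.obj (op V')) :
    germAt hbasis hH p hx h (s ≫ H.map (homOfLE h').op) =
      germAt hbasis hH p hx (h.trans h') s := by
  have e : (s ≫ H.map (homOfLE h').op) ≫ H.map (homOfLE h).op =
      s ≫ H.map (homOfLE (h.trans h')).op := by
    rw [Category.assoc, ← H.map_comp]
    rfl
  exact congrArg ((ballSystem hbasis hH Z).germ p x hx) e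

theorem germAt_of_le (hpq : p ≤ q) (hx : x ∈ p.base) (hx' : x ∈ q.base) (h : q.U.obj ≤ V)
    (s : Z ⟶ H.obj (op V)) :
    germAt hbasis hH p hx ((Decomp.U_le (fun _ h => h) hpq).le.trans h) s =
      germAt hbasis hH q hx' h s := by
  have e : s ≫ H.map (homOfLE ((Decomp.U_le (fun _ h => h) hpq).le.trans h)).op =
      (s ≫ H.map (homOfLE h).op) ≫ H.map (homOfLE (Decomp.U_le (fun _ h => h) hpq).le).op := by
    rw [Category.assoc, ← H.map_comp]
    rfl
  exact (congrArg ((ballSystem hbasis hH Z).germ p x hx) e).trans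
    (LocalSystem.germ_res (S := ballSystem hbasis hH Z) hpq hx hx' _)

/-- Two choices of balls around the configuration are compared on a common refinement. This makes
`toSection` independent of the choices in its definition. -/
theorem germAt_eq {x' : Conf k M} (hxx : x = x') (hx : x ∈ p.base) (hx' : x' ∈ q.base) (h : p.U.obj ≤ V) (h' : q.U.obj ≤ V)
    (s : Z ⟶ H.obj (op V)) : germAt hbasis hH p hx h s = germAt hbasis hH q hx' h' s := by
  subst hxx
  obtain ⟨r, hrp, hrq, hr⟩ := (ballSystem hbasis hH Z).directed hx hx'
  rw [← germAt_of_le hbasis hH hrp hr hx h, ← germAt_of_le hbasis hH hrq hr hx' h']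

omit [T2Space M] [ChartedSpace (EuclideanSpace ℝ (Fin n)) M] in
theorem comp_map_refl (s : Z ⟶ H.obj (op V)) : s ≫ H.map (homOfLE (le_refl V)).op = s :=
  (congrArg (s ≫ ·) (H.map_id _)).trans (Category.comp_id _)

theorem germAt_injective (hx : x ∈ p.base) {s s' : Z ⟶ H.obj (op p.U.obj)}
    (hs : germAt hbasis hH p hx le_rfl s = germAt hbasis hH p hx le_rfl s') : s = s' := by
  exact (comp_map_refl s).symm.trans ((LocalSystem.germ_injective hx hs).trans (comp_map_refl s'))

theorem exists_germAt_eq (hx : x ∈ p.base) {e : (ballSystem hbasis hH Z).Total}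
    (he : (ballSystem hbasis hH Z).proj e = x) :
    ∃ s : Z ⟶ H.obj (op p.U.obj), germAt hbasis hH p hx le_rfl s = e := by
  obtain ⟨s, hs⟩ := LocalSystem.exists_germ_eq hx e he
  exact ⟨s, (congrArg ((ballSystem hbasis hH Z).germ p x hx) (comp_map_refl s)).trans hs⟩

include hbasis in
theorem exists_base (U : Opens M) (x : Conf k M) (hx : ∀ i, x.1 i ∈ U) :
    ∃ p : Decomp n {V : Opens M | IsBall n V} k, x ∈ p.base ∧ p.U.obj ≤ U := by
  obtain ⟨p, hp, hpU⟩ := Decomp.exists_mem_base (n := n) hbasis x (fun _ => U) hx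
  exact ⟨p, hp, by rw [p.eq]; exact iSup_le hpU⟩

/-- The section of germs over the configurations in `U` defined by a morphism `Z ⟶ H U`. -/
noncomputable def toSection {U : Opens M} (s : Z ⟶ H.obj (op U)) (c : Conf k U) :
    (ballSystem hbasis hH Z).Total :=
  germAt hbasis hH (exists_base hbasis U (Conf.incl U c) fun i => (c.1 i).2).choose
    (exists_base hbasis U (Conf.incl U c) fun i => (c.1 i).2).choose_spec.1
    (exists_base hbasis U (Conf.incl U c) fun i => (c.1 i).2).choose_spec.2 s

theorem toSection_eq {U : Opens M} (s : Z ⟶ H.obj (op U)) {c : Conf k U}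
    (hc : Conf.incl U c ∈ p.base) (h : p.U.obj ≤ U) :
    toSection hbasis hH s c = germAt hbasis hH p hc h s :=
  germAt_eq hbasis hH rfl _ _ _ _ s

theorem proj_toSection {U : Opens M} (s : Z ⟶ H.obj (op U)) (c : Conf k U) :
    (ballSystem hbasis hH Z).proj (toSection hbasis hH s c) = Conf.incl U c := rfl

theorem continuous_toSection {U : Opens M} (s : Z ⟶ H.obj (op U)) :
    Continuous (toSection (k := k) hbasis hH s) := by
  refine LocalSystem.continuous_of_eventually_eq_germ (Conf.continuous_incl U) fun c => ?_
  obtain ⟨p, hp, hpU⟩ := exists_base hbasis U (Conf.incl U c) fun i => (c.1 i).2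
  refine ⟨p, s ≫ H.map (homOfLE hpU).op, ?_⟩
  filter_upwards [(p.isOpen_base.preimage (Conf.continuous_incl U)).mem_nhds hp] with c' hc'
  exact ⟨hc', toSection_eq hbasis hH s hc' hpU⟩

theorem toSection_res {U W : Opens M} (h : U ≤ W) (s : Z ⟶ H.obj (op W)) (c : Conf k U) :
    toSection hbasis hH (s ≫ H.map (homOfLE h).op) c =
      toSection hbasis hH s (Conf.map (Opens.inclusion h) (Set.inclusion_injective h) c) := by
  obtain ⟨p, hp, hpU⟩ := exists_base hbasis U (Conf.incl U c) fun i => (c.1 i).2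
  rw [toSection_eq hbasis hH _ hp hpU, germAt_res]
  exact (toSection_eq hbasis hH s (c := Conf.map (Opens.inclusion h)
    (Set.inclusion_injective h) c) hp (hpU.trans h)).symm

/-- Reordering the points of a configuration acts on germs. -/
def permGerm (e : Fin k ≃ Fin k) :
    (ballSystem hbasis hH Z).Total → (ballSystem hbasis hH Z).Total :=
  Quotient.lift (fun g => (ballSystem hbasis hH Z).germ (g.idx.perm e) (g.pt.perm e)
    (fun i => g.mem (e i)) g.val) (by
      rintro ⟨p, x, hx, a⟩ ⟨q, y, hy, b⟩ ⟨rfl, r, h, h', hr, hab⟩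
      exact LocalSystem.germ_eq_iff.mpr ⟨r.perm e, fun i => h (e i), fun i => h' (e i),
        fun i => hr (e i), hab⟩)

theorem permGerm_germAt (e : Fin k ≃ Fin k) (hx : x ∈ p.base) (h : p.U.obj ≤ V)
    (s : Z ⟶ H.obj (op V)) :
    permGerm hbasis hH e (germAt hbasis hH p hx h s) =
      germAt hbasis hH (p.perm e) (x := x.perm e) (fun i => hx (e i)) h s := rfl

theorem proj_permGerm (e : Fin k ≃ Fin k) (g : (ballSystem hbasis hH Z).Total) :
    (ballSystem hbasis hH Z).proj (permGerm hbasis hH e g) =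
      ((ballSystem hbasis hH Z).proj g).perm e := by
  obtain ⟨g⟩ := g
  rfl

theorem continuous_permGerm (e : Fin k ≃ Fin k) :
    Continuous (permGerm (Z := Z) hbasis hH e) := by
  refine LocalSystem.continuous_of_eventually_eq_germ
    ((Conf.continuous_perm e).comp LocalSystem.continuous_proj) fun g => ?_
  obtain ⟨p, hp, a, hg⟩ := LocalSystem.exists_eq_germ _ g
  refine ⟨p.perm e, a, ?_⟩
  filter_upwards [LocalSystem.eventually_eq_germ continuous_id (fun _ => rfl) hg] with g' hg'
  obtain ⟨hz, hg'⟩ := hg'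
  refine ⟨fun i => hz (e i), ?_⟩
  exact congrArg (permGerm hbasis hH e) hg'

theorem toSection_perm {U : Opens M} (s : Z ⟶ H.obj (op U)) (e : Fin k ≃ Fin k) (c : Conf k U) :
    toSection hbasis hH s (c.perm e) = permGerm hbasis hH e (toSection hbasis hH s c) := by
  obtain ⟨p, hp, hpU⟩ := exists_base hbasis U (Conf.incl U c) fun i => (c.1 i).2
  rw [toSection_eq hbasis hH s hp hpU, permGerm_germAt]
  exact toSection_eq hbasis hH s (c := c.perm e) (p := p.perm e) (fun i => hp (e i)) hpU

variable (n) in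
/-- A configuration in `U` contained in a disjoint union of less than `k` balls of `U`. -/
def Conf.IsClustered {U : Opens M} (c : Conf k U) : Prop :=
  ∃ V ≤ U, IsBallUnionLE n ((k : ℤ) - 1) V ∧ ∀ i, (c.1 i : M) ∈ V

variable [HasZeroMorphisms C]

variable (Z) in
/-- The zero section. -/
noncomputable def zeroSection (x : Conf k M) : (ballSystem hbasis hH Z).Total :=
  toSection hbasis hH (0 : Z ⟶ H.obj (op ⊤)) (Conf.lift x fun _ => trivial)

theorem continuous_zeroSection : Continuous (zeroSection (k := k) hbasis hH Z) :=
  (continuous_toSection hbasis hH _).comp (Conf.continuous_lift continuous_id _)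

theorem proj_zeroSection (x : Conf k M) :
    (ballSystem hbasis hH Z).proj (zeroSection hbasis hH Z x) = x := rfl

theorem germAt_zero (hx : x ∈ p.base) (h : p.U.obj ≤ V) :
    germAt hbasis hH p hx h (0 : Z ⟶ H.obj (op V)) = zeroSection hbasis hH Z x := by
  refine Eq.trans ?_ (toSection_eq hbasis hH _ (c := Conf.lift (U := ⊤) x fun _ => trivial)
    hx le_top).symm
  unfold germAt
  rw [zero_comp, zero_comp]
  rfl

variable (hzero : ∀ V : Opens M, IsBallUnionLE n ((k : ℤ) - 1) V → IsZero (H.obj (op V)))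
include hzero

/-- Near `c` the section factors through `H V` with `V` a union of fewer than `k` balls, and `H V`
is zero. -/
theorem toSection_of_isClustered {U : Opens M} (s : Z ⟶ H.obj (op U)) {c : Conf k U}
    (hc : c.IsClustered n) : toSection hbasis hH s c = zeroSection hbasis hH Z (Conf.incl U c) := by
  obtain ⟨V, hVU, hV, hcV⟩ := hc
  obtain ⟨p, hp, hpV⟩ := exists_base hbasis V (Conf.incl U c) hcV
  rw [toSection_eq hbasis hH s hp (hpV.trans hVU), ← germAt_res hbasis hH hp hpV hVU,
    (hzero V hV).eq_of_tgt (s ≫ H.map (homOfLE hVU).op) 0, germAt_zero]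

variable {U : Opens M} {σ : Conf k U → (ballSystem hbasis hH Z).Total} (hσ : Continuous σ)
  (hσp : ∀ c, (ballSystem hbasis hH Z).proj (σ c) = Conf.incl U c)
  (hσe : ∀ (e : Fin k ≃ Fin k) (c : Conf k U), σ (c.perm e) = permGerm hbasis hH e (σ c))
  (hσz : ∀ c : Conf k U, c.IsClustered n → σ c = zeroSection hbasis hH Z (Conf.incl U c))
include hσ hσp hσe hσz

/-- An equivariant section vanishing on clustered configurations is locally given by unique
morphisms. -/
theorem existsUnique_of_isBallUnionLE (hVU : V ≤ U) (hV : IsBallUnionLE n (k : ℤ) V) :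
    ∃! s : Z ⟶ H.obj (op V), ∀ (p : Decomp n {V : Opens M | IsBall n V} k) (h : p.U.obj ≤ V)
      (c : Conf k U) (hc : Conf.incl U c ∈ p.base), σ c = germAt hbasis hH p hc h s := by
  rcases hV.isBallUnion_or with hV | hV
  swap
  · refine ⟨0, fun p h c hc => ?_, fun s _ => (hzero V hV).eq_of_tgt _ _⟩
    rw [germAt_zero, hσz c ⟨V, hVU, hV, fun i => h (p.T_le i (hc i))⟩]
  obtain ⟨T, hT, hd, rfl⟩ := hV
  let q : Decomp n {V : Opens M | IsBall n V} k := Decomp.mk' T hT hd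
  have hqU : ∀ x ∈ q.base, ∀ i, x.1 i ∈ U := fun x hx i => hVU (q.T_le i (hx i))
  obtain ⟨x₀, hx₀⟩ := q.base_nonempty fun _ h => h
  have hq : q.U.obj ≤ ⨆ i, T i := le_rfl
  obtain ⟨s, hs⟩ : ∃ s : Z ⟶ H.obj (op (⨆ i, T i)), germAt hbasis hH q hx₀ hq s =
      σ (Conf.lift x₀ (hqU x₀ hx₀)) :=
    exists_germAt_eq hbasis hH hx₀ (hσp (Conf.lift x₀ (hqU x₀ hx₀)))
  have : PreconnectedSpace q.base :=
    Subtype.preconnectedSpace (q.base_isPreconnected fun _ h => h)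
  have hsq : ∀ (c : Conf k U) (hc : Conf.incl U c ∈ q.base),
      σ c = germAt hbasis hH q hc hq s := by
    -- The configurations adapted to `T` are connected, so the germ at `x₀` determines the section
    -- there.
    intro c hc
    exact LocalSystem.eq_germ_of_preconnected (S := ballSystem hbasis hH Z) (p := q)
      (f := fun y : q.base => σ (Conf.lift y.1 (hqU y.1 y.2)))
      (hσ.comp (Conf.continuous_lift continuous_subtype_val fun y => hqU y.1 y.2))
      (g := Subtype.val) (fun y => hσp _) (fun y => y.2) (y₀ := ⟨x₀, hx₀⟩) hs.symm ⟨_, hc⟩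
  refine ⟨s, fun p h c hc => ?_, fun s' hs' => ?_⟩
  · obtain ⟨π, hπ⟩ := exists_componentMap (T := p.T) p.mem hd (by rw [← p.eq]; exact h)
    -- A general `p` in `V` has at most one ball in each `T i`, up to reordering, or misses some `T
    -- i`. Equivariance settles the former case; in the latter `p` lies in fewer than `k` balls and
    -- both sides vanish.
    by_cases hπs : Function.Surjective π
    · let e : Fin k ≃ Fin k :=
        Equiv.ofBijective π ⟨Finite.injective_iff_surjective.mpr hπs, hπs⟩
      have hce : Conf.incl U (c.perm e.symm) ∈ q.base := fun i => by
        have := hπ (e.symm i) (hc (e.symm i))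
        rwa [show π (e.symm i) = i from e.apply_symm_apply i] at this
      have h1 := hsq (c.perm e.symm) hce
      have h2 : (c.perm e.symm).perm e = c := Subtype.ext (by ext1 i; simp [Conf.perm])
      have h3 := hσe e (c.perm e.symm)
      rw [h1, permGerm_germAt, h2] at h3
      rw [h3]
      exact germAt_eq hbasis hH (p := q.perm e) (congrArg (Conf.incl U) h2) (fun i => hce (e i)) hc
        hq h s
    · have hW := isBallUnionLE_range hT hd hπs
      have hpW : p.U.obj ≤ ⨆ i, T (π i) := by rw [p.eq]; exact iSup_mono hπ
      have hWV : ⨆ i, T (π i) ≤ ⨆ i, T i := iSup_le fun i => le_iSup T (π i)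
      rw [hσz c ⟨_, hWV.trans hVU, hW, fun i => hpW (p.T_le i (hc i))⟩,
        ← germAt_res hbasis hH hc hpW hWV, (hzero _ hW).eq_of_tgt (s ≫ _) 0, germAt_zero]
  · refine germAt_injective hbasis hH hx₀ ?_
    exact (hs' q le_rfl (Conf.lift x₀ (hqU x₀ hx₀)) hx₀).symm.trans
      (hsq (Conf.lift x₀ (hqU x₀ hx₀)) hx₀)

end Sections

/-! ### Isotopy invariance of the polynomial extension -/

section VeryGood

variable {n : ℕ} {M : Type u} [TopologicalSpace M] [ChartedSpace (EuclideanSpace ℝ (Fin n)) M]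
  {C : Type v} [Category.{w} C] {k : ℕ} {H : (Opens M)ᵒᵖ ⥤ C}

theorem IsPolynomial.nonempty_isLimit [HasLimitsOfSize.{u, u} C] (hpoly : IsPolynomial n k H)
    (U : Opens M) : Nonempty (IsLimit (smallCone n H k U)) := by
  have : IsIso ((limit.isLimit (smallDiagram n H k U)).lift (smallCone n H k U)) := hpoly U
  exact ⟨(limit.isLimit _).ofPointIso⟩

theorem isPolynomial_of_isLimit [HasLimitsOfSize.{u, u} C]
    (h : ∀ U, Nonempty (IsLimit (smallCone n H k U))) : IsPolynomial n k H := by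
  intro U
  obtain ⟨hl⟩ := h U
  exact (hl.conePointUniqueUpToIso (limit.isLimit (smallDiagram n H k U))).isIso_hom

variable [T2Space M] (hbasis : Opens.IsBasis {V : Opens M | IsBall n V})
  (hH : IsVeryGood n (IsoSub.ι n (IsDisjUnion {V : Opens M | IsBall n V} k))
    ((IsoSub.ι n (IsDisjUnion {V : Opens M | IsBall n V} k)).op ⋙ H)) {Z : C}
  [HasZeroMorphisms C]
  (hzero : ∀ V : Opens M, IsBallUnionLE n ((k : ℤ) - 1) V → IsZero (H.obj (op V)))
include hzero

section

variable {U : Opens M} (hlim : IsLimit (smallCone n H k U))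
include hlim

/-- `H U` is the limit over unions of at most `k` balls, and on each of these the section determines
the morphism. -/
theorem eq_of_toSection_eq {s s' : Z ⟶ H.obj (op U)}
    (h : ∀ c, toSection hbasis hH s c = toSection hbasis hH s' c) : s = s' := by
  refine hlim.hom_ext fun V => ?_
  refine (existsUnique_of_isBallUnionLE hbasis hH hzero (continuous_toSection hbasis hH s)
    (proj_toSection hbasis hH s) (toSection_perm hbasis hH s)
    (fun c => toSection_of_isClustered hbasis hH hzero s) V.unop.property.1
    V.unop.property.2).unique ?_ ?_
  · intro p hp c hc
    exact (toSection_eq hbasis hH s hc (hp.trans V.unop.property.1)).trans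
      (germAt_res hbasis hH hc hp V.unop.property.1 s).symm
  · intro p hp c hc
    exact (h c).trans ((toSection_eq hbasis hH s' hc (hp.trans V.unop.property.1)).trans
      (germAt_res hbasis hH hc hp V.unop.property.1 s').symm)

/-- The morphisms that represent `σ` on unions of at most `k` balls are unique, hence compatible
with restriction, hence form a cone. -/
theorem exists_toSection_eq {σ : Conf k U → (ballSystem hbasis hH Z).Total} (hσ : Continuous σ)
    (hσp : ∀ c, (ballSystem hbasis hH Z).proj (σ c) = Conf.incl U c)
    (hσe : ∀ (e : Fin k ≃ Fin k) (c : Conf k U), σ (c.perm e) = permGerm hbasis hH e (σ c))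
    (hσz : ∀ c : Conf k U, c.IsClustered n → σ c = zeroSection hbasis hH Z (Conf.incl U c)) :
    ∃ s : Z ⟶ H.obj (op U), ∀ c, toSection hbasis hH s c = σ c := by
  have hex := fun V : SmallOpens n k U => existsUnique_of_isBallUnionLE hbasis hH hzero hσ hσp hσe
    hσz V.property.1 V.property.2
  choose t ht htu using hex
  let c : Cone (smallDiagram n H k U) :=
    { pt := Z
      π :=
        { app := fun V => t V.unop
          naturality := fun V V' f => by
            refine (Category.id_comp _).trans (Eq.symm (htu V'.unop _ fun p hp c hc => ?_))
            have hle : V'.unop.obj ≤ V.unop.obj := leOfHom f.unop.hom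
            exact (ht V.unop p (hp.trans hle) c hc).trans
              (germAt_res hbasis hH hc hp hle (t V.unop)).symm } }
  let s : Z ⟶ H.obj (op U) := hlim.lift c
  refine ⟨s, fun x => ?_⟩
  obtain ⟨p, hp, hpU⟩ := exists_base hbasis U (Conf.incl U x) fun i => (x.1 i).2
  let V : SmallOpens n k U := ⟨p.U.obj, hpU, IsBallUnion.isBallUnionLE p.U.property⟩
  have hfac : s ≫ H.map (homOfLE hpU).op = t V := hlim.fac c (op V)
  have h1 := ht V p le_rfl x hp
  rw [← hfac] at h1
  exact (toSection_eq hbasis hH s hp hpU).trans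
    ((germAt_res hbasis hH hp le_rfl hpU s).symm.trans h1.symm)

end

include hbasis hH in
/-- A polynomial functor of degree `≤ k` which vanishes on unions of less than `k` balls and is
very good on unions of `k` balls is very good. -/
theorem isIso_map_of_isIsotopyEquiv (hlim : ∀ U, Nonempty (IsLimit (smallCone n H k U)))
    {U W : Opens M} (hUW : U ≤ W) (h : IsIsotopyEquiv n U W) : IsIso (H.map (homOfLE hUW).op) := by
  rw [isIso_iff_yoneda_map_bijective]
  intro Z
  obtain ⟨_, L, hL⟩ := h
  obtain ⟨hlU⟩ := hlim U
  obtain ⟨hlW⟩ := hlim W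
  have hcov := LocalSystem.isCoveringMap_proj (S := ballSystem hbasis hH Z)
  have hL1 : Function.Surjective fun x : U => L (x, 1) := by
    have h1 := hL.one
    rwa [Set.range_eq_univ.mpr (fun x => ⟨x, rfl⟩ : Function.Surjective (Opens.inclusion
      (le_refl W))), Set.range_eq_univ] at h1
  -- The end of the isotopy is a diffeomorphism from `U` to `W`; its inverse `E` on configurations
  -- gives the starting point of the track that ends at a given configuration.
  obtain ⟨e, he⟩ := (hL.isSmoothEmb 1).exists_diffeo hL1
  let K : unitInterval → Conf k U → Conf k W := fun t =>
    Conf.map (fun x => L (x, t)) (hL.isSmoothEmb t).isEmbedding.injective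
  have hKc : Continuous fun p : unitInterval × Conf k U => K p.1 p.2 :=
    Continuous.subtype_mk (continuous_pi fun i => hL.continuous.comp
      (((continuous_apply i).comp (continuous_subtype_val.comp continuous_snd)).prodMk
        continuous_fst)) _
  have hKp : ∀ c, Continuous fun t => K t c := fun c =>
    hKc.comp (continuous_id.prodMk continuous_const)
  have hK0 : ∀ c, K 0 c = Conf.map (Opens.inclusion hUW) (Set.inclusion_injective hUW) c :=
    fun c => Subtype.ext (funext fun i => hL.zero (c.1 i))
  let E : Conf k W → Conf k U := Conf.map e.symm e.symm.injective
  have hE : Continuous E := Conf.continuous_map _ e.symm.continuous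
  have hK1E : ∀ c, K 1 (E c) = c := fun c => Subtype.ext (funext fun i => by
    change (fun x => L (x, 1)) (e.symm (c.1 i)) = c.1 i
    rw [← he]; exact e.apply_symm_apply _)
  have hEK1 : ∀ c, E (K 1 c) = c := fun c => Subtype.ext (funext fun i => by
    change e.symm ((fun x => L (x, 1)) (c.1 i)) = c.1 i
    rw [← he]; exact e.symm_apply_apply _)
  constructor
  · intro s s' hs
    simp only at hs
    -- Injectivity: the two sections agree at the start of the track ending at `c`, which lies in
    -- `U`, so by unique path lifting they agree at `c`.
    refine eq_of_toSection_eq hbasis hH hzero hlW fun c => ?_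
    have := congrFun (hcov.eq_of_comp_eq
      ((continuous_toSection hbasis hH s).comp (hKp (E c)))
      ((continuous_toSection hbasis hH s').comp (hKp (E c))) rfl 0 (by
        simp only [Function.comp_apply, hK0]
        rw [← toSection_res, ← toSection_res, hs])) 1
    simpa only [Function.comp_apply, hK1E] using this
  · intro r
    let ρ : C(Conf k U, (ballSystem hbasis hH Z).Total) := ⟨_, continuous_toSection hbasis hH r⟩
    let Hm : C(unitInterval × Conf k U, Conf k M) :=
      ⟨fun p => Conf.incl W (K p.1 p.2), (Conf.continuous_incl W).comp hKc⟩
    have hHm0 : ∀ c, Hm (0, c) = (ballSystem hbasis hH Z).proj (ρ c) := fun c => by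
      change Conf.incl W (K 0 c) = Conf.incl U c
      rw [hK0]
      rfl
    -- Surjectivity: `Λ` transports the section of `r` along the isotopy, and its value at time `1`
    -- is the candidate section on `W`.
    let Λ := hcov.liftHomotopy Hm ρ hHm0
    have hΛp : ∀ t c, (ballSystem hbasis hH Z).proj (Λ (t, c)) = Conf.incl W (K t c) :=
      fun t c => congrFun (hcov.liftHomotopy_lifts Hm ρ hHm0) (t, c)
    have hΛ0 : ∀ c, Λ (0, c) = toSection hbasis hH r c := hcov.liftHomotopy_zero Hm ρ hHm0
    have hΛc : ∀ c, Continuous fun t => Λ (t, c) := fun c =>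
      Λ.continuous.comp (continuous_id.prodMk continuous_const)
    obtain ⟨s, hs⟩ := exists_toSection_eq hbasis hH hzero hlW (σ := fun c => Λ (1, E c))
      (Λ.continuous.comp (continuous_const.prodMk hE))
      (fun c => by rw [hΛp, hK1E])
      (fun π c => by
        refine congrFun (hcov.eq_of_comp_eq (hΛc (E (c.perm π)))
          ((continuous_permGerm hbasis hH π).comp (hΛc (E c))) ?_ 0 ?_) 1
        · ext1 t
          simp only [Function.comp_apply, hΛp, proj_permGerm]
          rfl
        · simp only [Function.comp_apply, hΛ0]
          exact toSection_perm hbasis hH r π (E c))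
      -- A diffeomorphism pulls balls back to balls, so the track starts at a clustered
      -- configuration, where the section of `r` vanishes. The transported germ and the zero section
      -- then agree along the track, even though intermediate configurations need not be clustered.
      (fun c hc => by
        obtain ⟨V, hVW, hV, hcV⟩ := hc
        have hEc : (E c).IsClustered n := by
          refine ⟨pullback e V, pullback_le e, hV.pullback e hVW, fun i => ?_⟩
          refine (mem_pullback e).mpr ?_
          change (e (e.symm (c.1 i)) : M) ∈ V
          rw [e.apply_symm_apply]
          exact hcV i
        have := congrFun (hcov.eq_of_comp_eq (hΛc (E c))
          ((continuous_zeroSection hbasis hH).comp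
            ((Conf.continuous_incl W).comp (hKp (E c)))) (by
              ext1 t
              simp only [Function.comp_apply, hΛp, proj_zeroSection]) 0 (by
              simp only [Function.comp_apply, hΛ0,
                toSection_of_isClustered hbasis hH hzero r hEc, hK0]
              rfl)) 1
        simpa only [Function.comp_apply, hK1E] using this)
    refine ⟨s, eq_of_toSection_eq hbasis hH hzero hlU fun c => ?_⟩
    rw [toSection_res, hs, ← hΛ0 c, ← hK0]
    -- The paths `t ↦ Λ (1, E (K t c))` and `t ↦ Λ (t, c)` lift the same track and agree at `t = 1`.
    -- Their equality at `t = 0` says that the new section restricts to that of `r`.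
    have h1 : Continuous fun t => Λ (1, E (K t c)) :=
      Λ.continuous.comp (continuous_const.prodMk (hE.comp (hKp c)))
    refine congrFun (hcov.eq_of_comp_eq h1 (hΛc c) ?_ 1 ?_) 0
    · ext1 t
      simp only [Function.comp_apply, hΛp, hK1E]
    · simp only [hEK1]

end VeryGood

/-! ### Right Kan extension from the basis to all unions of `k` balls -/

section Kan

variable {n : ℕ} {M : Type u} [TopologicalSpace M] [ChartedSpace (EuclideanSpace ℝ (Fin n)) M]
  [T2Space M] {C : Type v} [Category.{w} C] {B : Set (Opens M)} {k : ℕ}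
  (hbasis : Opens.IsBasis B) (hball : ∀ V ∈ B, IsBall n V)

include hbasis hball in
theorem exists_basisSub_isIsotopyEquiv (V : BallSub n M k) :
    ∃ U : BasisSub n B k, IsIsotopyEquiv n U.obj V.obj := by
  obtain ⟨_, T, hT, hd, rfl⟩ := V
  obtain ⟨x, hx⟩ := Decomp.base_nonempty (fun _ h => h) (Decomp.mk' (n := n) T hT hd)
  obtain ⟨p, -, hp⟩ := Decomp.exists_mem_base (n := n) hbasis x T hx
  exact ⟨p.U, Decomp.isIsotopyEquiv_iSup hball hT hd hp⟩

theorem exists_structuredArrow (V : (BallSub n M k)ᵒᵖ) (hbasis : Opens.IsBasis B) :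
    Nonempty (StructuredArrow V (basisIncl n hball k).op) := by
  obtain ⟨U, hU⟩ := exists_basisSub_isIsotopyEquiv hbasis hball V.unop
  exact ⟨StructuredArrow.mk (Y := op U)
    (homOfLE hU : (basisIncl n hball k).obj U ⟶ V.unop).op⟩

variable {G : (BasisSub n B k)ᵒᵖ ⥤ C} (hG : IsVeryGood n (IsoSub.ι n (IsDisjUnion B k)) G)
  {F : (BallSub n M k)ᵒᵖ ⥤ C} (α : (basisIncl n hball k).op ⋙ F ⟶ G)

include hbasis hG

section

variable [HasLimitsOfSize.{u, u} C]

/-- These composites are the legs of the pointwise limit cone. -/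
theorem isIso_map_comp_app_of_isRightKanExtension [F.IsRightKanExtension α]
    {V : (BallSub n M k)ᵒᵖ} (j : StructuredArrow V (basisIncl n hball k).op) :
    IsIso (F.map j.hom ≫ α.app j.right) :=
  isIso_π_app hball hbasis hG (c := (Functor.RightExtension.mk F α).coneAt V)
    (Functor.isPointwiseRightKanExtensionOfIsRightKanExtension F α V) j

theorem isIso_of_isRightKanExtension [F.IsRightKanExtension α] : IsIso α := by
  have : ∀ U, IsIso (α.app U) := fun U => by
    have := isIso_map_comp_app_of_isRightKanExtension hbasis hball hG α
      (StructuredArrow.mk (Y := U) (𝟙 ((basisIncl n hball k).op.obj U)))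
    simpa using this
  exact NatIso.isIso_of_isIso_app α

/-- `F` inverts every arrow to a basis object. Any morphism, followed by such an arrow, is another
one, so cancellation applies. -/
theorem isVeryGood_of_isRightKanExtension [F.IsRightKanExtension α] :
    IsVeryGood n (IsoSub.ι n (IsBallUnion (M := M) n k)) F := by
  have := isIso_of_isRightKanExtension hbasis hball hG α
  have key : ∀ {V : (BallSub n M k)ᵒᵖ} (j : StructuredArrow V (basisIncl n hball k).op),
      IsIso (F.map j.hom) := fun j => by
    have := isIso_map_comp_app_of_isRightKanExtension hbasis hball hG α j
    exact IsIso.of_isIso_comp_right (F.map j.hom) (α.app j.right)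
  intro a b f _
  obtain ⟨j⟩ := exists_structuredArrow (n := n) (k := k) hball (op a) hbasis
  have h₁ := key j
  have h₂ := key (StructuredArrow.mk (Y := j.right) (f.op ≫ j.hom))
  have h₃ : IsIso (F.map f.op ≫ F.map j.hom) := by rw [← F.map_comp]; exact h₂
  exact IsIso.of_isIso_comp_right (F.map f.op) (F.map j.hom)

end

/-- The comparison with the limit becomes an isomorphism after one projection, which is itself an
isomorphism. -/
theorem isRightKanExtension_of_isIso [HasLimitsOfSize.{u, u} C]
    (hF : IsVeryGood n (IsoSub.ι n (IsBallUnion (M := M) n k)) F)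
    (hα : IsIso α) : F.IsRightKanExtension α := by
  refine Functor.RightExtension.IsPointwiseRightKanExtension.isRightKanExtension
    (E := Functor.RightExtension.mk F α) fun V => ?_
  let c := (Functor.RightExtension.mk F α).coneAt V
  let hl := limit.isLimit (StructuredArrow.proj V (basisIncl n hball k).op ⋙ G)
  have : IsIso (hl.lift c) := by
    obtain ⟨j⟩ := exists_structuredArrow (n := n) (k := k) hball V hbasis
    have h₁ := isIso_π_app hball hbasis hG hl j
    have h₂ : IsIso (hl.lift c ≫ (limit.cone
        (StructuredArrow.proj V (basisIncl n hball k).op ⋙ G)).π.app j) := by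
      rw [hl.fac]
      have := hF.isIso_map j.hom
      exact inferInstanceAs (IsIso (F.map j.hom ≫ α.app j.right))
    exact IsIso.of_isIso_comp_right (hl.lift c) ((limit.cone
      (StructuredArrow.proj V (basisIncl n hball k).op ⋙ G)).π.app j)
  exact hl.ofPointIso

end Kan

/-! ### Vanishing of the lower approximation -/

section Homogeneous

variable {n : ℕ} {M : Type u} [TopologicalSpace M] [ChartedSpace (EuclideanSpace ℝ (Fin n)) M]
  {C : Type v} [Category.{w} C] {k : ℕ} {H : (Opens M)ᵒᵖ ⥤ C} [HasLimitsOfSize.{u, u} C]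

/-- Since `U` belongs to its own indexing poset, `H U` is a retract of the approximation. -/
theorem isZero_of_isZero_polyApprox [HasZeroMorphisms C] {m : ℤ} {U : Opens M}
    (hU : IsBallUnionLE n m U) (h : IsZero (polyApprox n H m U)) : IsZero (H.obj (op U)) := by
  let V : SmallOpens n m U := ⟨U, le_rfl, hU⟩
  rw [IsZero.iff_id_eq_zero]
  have h₁ : toPolyApprox n H m U ≫ limit.π (smallDiagram n H m U) (op V) = 𝟙 _ :=
    (limit.lift_π _ _).trans (H.map_id _)
  rw [← h₁, h.eq_of_tgt (toPolyApprox n H m U) 0]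
  exact zero_comp

theorem isZero_polyApprox [HasZeroMorphisms C] {m : ℤ}
    (h : ∀ V : Opens M, IsBallUnionLE n m V → IsZero (H.obj (op V))) (U : Opens M) :
    IsZero (polyApprox n H m U) := by
  rw [IsZero.iff_id_eq_zero]
  exact limit.hom_ext fun V => (h _ V.unop.property.2).eq_of_tgt _ _

end Homogeneous

/-! ### Natural transformations between homogeneous functors -/

section Hom

variable {n : ℕ} {M : Type u} [TopologicalSpace M] [ChartedSpace (EuclideanSpace ℝ (Fin n)) M]
  {C : Type v} [Category.{w} C] {k : ℕ} {H H' : (Opens M)ᵒᵖ ⥤ C}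

theorem map_eq_zero_of_le [HasZeroMorphisms C] {U W V : Opens M} (hUW : U ≤ W) (hWV : W ≤ V)
    (hW : IsZero (H.obj (op W))) : H.map (homOfLE (hUW.trans hWV)).op = 0 := by
  have h : H.map (homOfLE (hUW.trans hWV)).op = H.map (homOfLE hWV).op ≫ H.map (homOfLE hUW).op :=
    H.map_comp _ _
  rw [h, hW.eq_of_tgt (H.map (homOfLE hWV).op) 0, zero_comp]

variable (hlim' : ∀ U, Nonempty (IsLimit (smallCone n H' k U)))
  (hzero' : ∀ V : Opens M, IsBallUnionLE n ((k : ℤ) - 1) V → IsZero (H'.obj (op V)))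
include hlim' hzero'

theorem hom_ext_of_ballSub {Γ Γ' : H ⟶ H'}
    (h : ∀ V : BallSub n M k, Γ.app (op V.obj) = Γ'.app (op V.obj)) : Γ = Γ' := by
  ext U
  induction U using Opposite.rec with | op U => ?_
  obtain ⟨hU⟩ := hlim' U
  refine hU.hom_ext fun V => ?_
  have e : Γ.app (op V.unop.obj) = Γ'.app (op V.unop.obj) := by
    rcases V.unop.property.2.isBallUnion_or with hV | hV
    · exact h ⟨_, hV⟩
    · exact (hzero' _ hV).eq_of_tgt _ _
  exact (Γ.naturality (homOfLE V.unop.property.1).op).symm.trans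
    ((congrArg (H.map (homOfLE V.unop.property.1).op ≫ ·) e).trans
      (Γ'.naturality (homOfLE V.unop.property.1).op))

/-- Extended by zero to fewer balls, `γ` stays natural: an inclusion that is not an isotopy
equivalence factors through a zero object on both sides. The limit property of `H'` then extends it
to all open sets. -/
theorem exists_hom_of_ballSub [HasZeroMorphisms C]
    (hzero : ∀ V : Opens M, IsBallUnionLE n ((k : ℤ) - 1) V → IsZero (H.obj (op V)))
    (γ : (IsoSub.ι n (IsBallUnion (M := M) n k)).op ⋙ H ⟶
      (IsoSub.ι n (IsBallUnion (M := M) n k)).op ⋙ H') :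
    ∃ Γ : H ⟶ H', ∀ V : BallSub n M k, Γ.app (op V.obj) = γ.app (op V) := by
  classical
  let δ : ∀ V : Opens M, H.obj (op V) ⟶ H'.obj (op V) := fun V =>
    if h : IsBallUnion n k V then γ.app (op ⟨V, h⟩) else 0
  have hδ : ∀ V : BallSub n M k, δ V.obj = γ.app (op V) := fun V => dif_pos V.property
  have hnat : ∀ {V W : Opens M} (h : V ≤ W), IsBallUnionLE n k V → IsBallUnionLE n k W →
      H.map (homOfLE h).op ≫ δ V = δ W ≫ H'.map (homOfLE h).op := by
    intro V W h hV hW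
    rcases hV.isBallUnion_or with hV | hV
    swap
    · exact (hzero' _ hV).eq_of_tgt _ _
    rcases hW.isBallUnion_or with hW | hW
    swap
    · exact (hzero _ hW).eq_of_src _ _
    rcases isIsotopyEquiv_or_factors hV hW h with hVW | ⟨X, hVX, hXW, hX⟩
    · have e := γ.naturality (X := op ⟨W, hW⟩) (Y := op ⟨V, hV⟩)
        (homOfLE hVW : (⟨V, hV⟩ : BallSub n M k) ⟶ ⟨W, hW⟩).op
      rw [← hδ, ← hδ] at e
      exact e
    · rw [map_eq_zero_of_le hVX hXW (hzero _ hX), map_eq_zero_of_le hVX hXW (hzero' _ hX),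
        zero_comp, comp_zero]
  have hlim := fun U => (hlim' U).some
  let c : ∀ U : Opens M, Cone (smallDiagram n H' k U) := fun U =>
    { pt := H.obj (op U)
      π :=
        { app := fun V => H.map (homOfLE V.unop.property.1).op ≫ δ V.unop.obj
          naturality := fun V W f => by
            have h : W.unop.obj ≤ V.unop.obj := leOfHom ((ObjectProperty.ι _).map f.unop)
            have e := hnat h W.unop.property.2 V.unop.property.2
            have e' : H.map (homOfLE W.unop.property.1).op =
                H.map (homOfLE V.unop.property.1).op ≫ H.map (homOfLE h).op := H.map_comp _ _
            refine (Category.id_comp _).trans ?_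
            rw [e', Category.assoc, e]
            exact (Category.assoc _ _ _).symm } }
  let Γ : ∀ U : Opens M, H.obj (op U) ⟶ H'.obj (op U) := fun U => (hlim U).lift (c U)
  have hΓ : ∀ {U V : Opens M} (h : V ≤ U), IsBallUnionLE n k V →
      Γ U ≫ H'.map (homOfLE h).op = H.map (homOfLE h).op ≫ δ V := fun {U V} h hV =>
    (hlim U).fac (c U) (op ⟨V, h, hV⟩)
  refine ⟨{ app := fun U => Γ U.unop, naturality := ?_ }, fun V => ?_⟩
  · intro U W f
    have h : W.unop ≤ U.unop := leOfHom f.unop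
    refine (hlim W.unop).hom_ext fun V => ?_
    have hV := V.unop.property.1
    change (H.map (homOfLE h).op ≫ Γ W.unop) ≫ H'.map (homOfLE hV).op =
      (Γ U.unop ≫ H'.map (homOfLE h).op) ≫ H'.map (homOfLE hV).op
    have e : H'.map (homOfLE h).op ≫ H'.map (homOfLE hV).op = H'.map (homOfLE (hV.trans h)).op :=
      (H'.map_comp _ _).symm
    have e' : H.map (homOfLE h).op ≫ H.map (homOfLE hV).op = H.map (homOfLE (hV.trans h)).op :=
      (H.map_comp _ _).symm
    rw [Category.assoc, Category.assoc, hΓ hV V.unop.property.2, e,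
      hΓ (hV.trans h) V.unop.property.2, ← e', Category.assoc]
  · have e := hΓ (le_refl V.obj) V.property.isBallUnionLE
    have e₁ : H.map (homOfLE (le_refl V.obj)).op = 𝟙 _ := H.map_id _
    have e₂ : H'.map (homOfLE (le_refl V.obj)).op = 𝟙 _ := H'.map_id _
    rw [e₁, e₂, Category.id_comp, Category.comp_id, hδ] at e
    exact e

end Hom

/-! ### Functoriality of extension by zero -/

section ExtensionByZero

variable {n : ℕ} {M : Type u} [TopologicalSpace M] [ChartedSpace (EuclideanSpace ℝ (Fin n)) M]
  {C : Type v} [Category.{w} C] {k : ℕ} (F : (BallSub n M k)ᵒᵖ ⥤ C)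

variable (n M k) in
/-- `𝓞_k(M)`, the poset of disjoint unions of at most `k` balls. -/
abbrev SmallSub := ObjectProperty.FullSubcategory (C := Opens M) (IsBallUnionLE n (k : ℤ))

open scoped Classical in
/-- The values of the extension by zero. -/
noncomputable def zeroExtObj [HasZeroObject C] (V : Opens M) : C :=
  if h : IsBallUnion n k V then F.obj (op ⟨V, h⟩) else (HasZeroObject.zero' C).zero

/-- The extension by zero has the given values on disjoint unions of exactly `k` balls. -/
noncomputable def zeroExtObjIso [HasZeroObject C] {V : Opens M} (h : IsBallUnion n k V) :
    zeroExtObj F V ≅ F.obj (op ⟨V, h⟩) := eqToIso (dif_pos h)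

theorem isZero_zeroExtObj [HasZeroObject C] {V : Opens M} (h : ¬ IsBallUnion n k V) :
    IsZero (zeroExtObj F V) := by
  rw [zeroExtObj, dif_neg h]
  exact isZero_zero C

variable [HasZeroObject C] [HasZeroMorphisms C]

open scoped Classical in
/-- The restriction maps of the extension by zero. -/
noncomputable def zeroExtMap {V W : Opens M} (_ : V ≤ W) : zeroExtObj F W ⟶ zeroExtObj F V :=
  if h : IsBallUnion n k V ∧ IsBallUnion n k W ∧ IsIsotopyEquiv n V W then
    (zeroExtObjIso F h.2.1).hom ≫
      F.map (homOfLE h.2.2 : (⟨V, h.1⟩ : BallSub n M k) ⟶ ⟨W, h.2.1⟩).op ≫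
        (zeroExtObjIso F h.1).inv
  else 0

theorem zeroExtMap_of_isIsotopyEquiv {V W : Opens M} (hVW : V ≤ W) (hV : IsBallUnion n k V)
    (hW : IsBallUnion n k W) (h : IsIsotopyEquiv n V W) :
    zeroExtMap F hVW = (zeroExtObjIso F hW).hom ≫
      F.map (homOfLE h : (⟨V, hV⟩ : BallSub n M k) ⟶ ⟨W, hW⟩).op ≫ (zeroExtObjIso F hV).inv :=
  dif_pos ⟨hV, hW, h⟩

theorem zeroExtMap_of_not {V W : Opens M} (hVW : V ≤ W) (h : ¬ IsIsotopyEquiv n V W) :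
    zeroExtMap F hVW = 0 :=
  dif_neg fun h' => h h'.2.2

theorem zeroExtMap_refl (V : Opens M) : zeroExtMap F (le_refl V) = 𝟙 _ := by
  by_cases h : IsBallUnion n k V
  · rw [zeroExtMap_of_isIsotopyEquiv F _ h h (IsIsotopyEquiv.refl V)]
    have : F.map (homOfLE (IsIsotopyEquiv.refl V) : (⟨V, h⟩ : BallSub n M k) ⟶ ⟨V, h⟩).op = 𝟙 _ :=
      F.map_id _
    rw [this, Category.id_comp, Iso.hom_inv_id]
  · exact (isZero_zeroExtObj F h).eq_of_src _ _

/-- An isotopy equivalence splits through `V` only into isotopy equivalences because `V` has at most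
`k` balls; conversely, if the composite is not one, some factor is not one either and both sides
vanish. -/
theorem zeroExtMap_comp [T2Space M] {U V W : Opens M} (hUV : U ≤ V) (hVW : V ≤ W)
    (hV : IsBallUnionLE n (k : ℤ) V) :
    zeroExtMap F hVW ≫ zeroExtMap F hUV = zeroExtMap F (hUV.trans hVW) := by
  by_cases hU : IsBallUnion n k U
  swap
  · exact (isZero_zeroExtObj F hU).eq_of_tgt _ _
  by_cases hW : IsBallUnion n k W
  swap
  · exact (isZero_zeroExtObj F hW).eq_of_src _ _
  by_cases h : IsIsotopyEquiv n U W
  · obtain ⟨j, hj, hV⟩ := hV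
    obtain ⟨rfl, h₁, h₂⟩ := isIsotopyEquiv_factor hU hV (by exact_mod_cast hj) hW hUV hVW h
    rw [zeroExtMap_of_isIsotopyEquiv F hUV hU hV h₁, zeroExtMap_of_isIsotopyEquiv F hVW hV hW h₂,
      zeroExtMap_of_isIsotopyEquiv F _ hU hW h]
    have e : F.map (homOfLE h : (⟨U, hU⟩ : BallSub n M j) ⟶ ⟨W, hW⟩).op =
        F.map (homOfLE h₂ : (⟨V, hV⟩ : BallSub n M j) ⟶ ⟨W, hW⟩).op ≫
        F.map (homOfLE h₁ : (⟨U, hU⟩ : BallSub n M j) ⟶ ⟨V, hV⟩).op := F.map_comp _ _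
    rw [e]
    simp
  · rw [zeroExtMap_of_not F _ h]
    by_cases h₁ : IsIsotopyEquiv n U V
    · rw [zeroExtMap_of_not F hVW fun h₂ => h (h₁.trans h₂), zero_comp]
    · rw [zeroExtMap_of_not F hUV h₁, comp_zero]

/-- The extension by zero of `F` to `𝓞_k(M)`. -/
noncomputable def zeroExt [T2Space M] : (SmallSub n M k)ᵒᵖ ⥤ C where
  obj V := zeroExtObj F V.unop.obj
  map f := zeroExtMap F (leOfHom ((ObjectProperty.ι _).map f.unop))
  map_id V := zeroExtMap_refl F V.unop.obj
  map_comp {_ V _} _ _ := (zeroExtMap_comp F _ _ V.unop.property).symm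

end ExtensionByZero

/-! ### Kan extension along `𝓞_k(M)` and polynomial functors -/

section RightKan

variable {n : ℕ} {M : Type u} [TopologicalSpace M] [ChartedSpace (EuclideanSpace ℝ (Fin n)) M]
  {C : Type v} [Category.{w} C] {k : ℕ} {H : (Opens M)ᵒᵖ ⥤ C} [HasLimitsOfSize.{u, u} C]

/-- The comma category in the pointwise Kan extension formula at `U` is the poset `𝓞_k(U)`; `j` and
`g` translate the indices and `ε` the values. -/
theorem nonempty_isLimit_smallCone {E : (SmallSub n M k)ᵒᵖ ⥤ C}
    (ε : (ObjectProperty.ι (IsBallUnionLE (M := M) n (k : ℤ))).op ⋙ H ⟶ E)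
    [H.IsRightKanExtension ε] [IsIso ε] (U : Opens M) :
    Nonempty (IsLimit (smallCone n H k U)) := by
  let L := (ObjectProperty.ι (IsBallUnionLE (M := M) n (k : ℤ))).op
  let hl : IsLimit ((Functor.RightExtension.mk H ε).coneAt (op U)) :=
    Functor.isPointwiseRightKanExtensionOfIsRightKanExtension H ε (op U)
  let j : StructuredArrow (op U) L → (SmallOpens n k U)ᵒᵖ := fun g =>
    op ⟨g.right.unop.obj, leOfHom g.hom.unop, g.right.unop.property⟩
  let c : Cone (smallDiagram n H k U) → Cone (StructuredArrow.proj (op U) L ⋙ E) := fun s =>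
    { pt := s.pt
      π :=
        { app := fun g => s.π.app (j g) ≫ ε.app g.right
          naturality := fun g g' f => by
            have h : g'.right.unop.obj ≤ g.right.unop.obj :=
              leOfHom ((ObjectProperty.ι _).map f.right.unop)
            have e : s.π.app (j g) ≫ H.map (homOfLE h).op = s.π.app (j g') :=
              s.w (ObjectProperty.homMk (homOfLE h) : (j g').unop ⟶ (j g).unop).op
            exact (Category.id_comp _).trans ((congrArg (· ≫ ε.app g'.right) e.symm).trans
              ((Category.assoc _ _ _).trans
                ((congrArg (s.π.app (j g) ≫ ·) (ε.naturality f.right)).trans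
                  (Category.assoc _ _ _).symm))) } }
  let g : (SmallOpens n k U)ᵒᵖ → StructuredArrow (op U) L := fun V =>
    StructuredArrow.mk (Y := (op ⟨V.unop.obj, V.unop.property.2⟩ : (SmallSub n M k)ᵒᵖ))
      (homOfLE V.unop.property.1 : V.unop.obj ⟶ U).op
  refine ⟨⟨fun s => hl.lift (c s), fun s V => ?_, fun s m hm => ?_⟩⟩
  · have e := hl.fac (c s) (g V)
    rw [← cancel_mono (ε.app (g V).right)]
    exact (Category.assoc _ _ _).trans e
  · refine hl.hom_ext fun f => ?_
    rw [hl.fac]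
    refine (Category.assoc _ _ _).symm.trans ?_
    exact congrArg (· ≫ ε.app f.right) (hm (j f))

end RightKan

/-! ### The characterisation and the equivalence -/

section Equivalence

variable {n : ℕ} {M : Type u} [TopologicalSpace M]
  [ChartedSpace (EuclideanSpace ℝ (Fin n)) M] {C : Type v} [Category.{w} C]
  {B : Set (Opens M)} {k : ℕ}

theorem isBasis_isBall (hbasis : Opens.IsBasis B) (hball : ∀ V ∈ B, IsBall n V) :
    Opens.IsBasis {V : Opens M | IsBall n V} := by
  rw [Opens.isBasis_iff_nbhd]
  intro U x hx
  obtain ⟨V, hV, h⟩ := Opens.isBasis_iff_nbhd.mp hbasis hx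
  exact ⟨V, hball V hV, h⟩

theorem comp_comp_hom_of_eq {A A' X X' Y Y' : C} {a : A ⟶ A'} {b : A' ⟶ Y'} {c : A ⟶ Y}
    {i : Y ≅ X} {g : X ⟶ X'} {j : Y' ≅ X'} (h : a ≫ b = c ≫ i.hom ≫ g ≫ j.inv) :
    a ≫ b ≫ j.hom = (c ≫ i.hom) ≫ g := by
  rw [← Category.assoc, h]
  simp

variable [T2Space M] [HasLimitsOfSize.{u, u} C]

/-- The values of an extension by zero on disjoint unions of exactly `k` balls. -/
noncomputable def ballSubIso [HasZeroObject C] [HasZeroMorphisms C] {F : (BallSub n M k)ᵒᵖ ⥤ C}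
    {H : (Opens M)ᵒᵖ ⥤ C}
    (ε : (ObjectProperty.ι (IsBallUnionLE (M := M) n (k : ℤ))).op ⋙ H ≅ zeroExt F) :
    (IsoSub.ι n (IsBallUnion (M := M) n k)).op ⋙ H ≅ F :=
  NatIso.ofComponents (fun V => ε.app (op ⟨V.unop.obj, V.unop.property.isBallUnionLE⟩) ≪≫
      zeroExtObjIso F V.unop.property) fun {V W} f => by
    have h : IsIsotopyEquiv n W.unop.obj V.unop.obj := leOfHom f.unop
    have e := ε.hom.naturality (X := op ⟨V.unop.obj, V.unop.property.isBallUnionLE⟩)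
      (Y := op ⟨W.unop.obj, W.unop.property.isBallUnionLE⟩) (ObjectProperty.homMk (homOfLE h.le)).op
    have e' : (zeroExt F).map (X := op ⟨V.unop.obj, V.unop.property.isBallUnionLE⟩)
        (Y := op ⟨W.unop.obj, W.unop.property.isBallUnionLE⟩)
        (ObjectProperty.homMk (homOfLE h.le)).op = (zeroExtObjIso F V.unop.property).hom ≫
          F.map f ≫ (zeroExtObjIso F W.unop.property).inv :=
      zeroExtMap_of_isIsotopyEquiv F h.le W.unop.property V.unop.property h
    rw [e'] at e
    exact comp_comp_hom_of_eq e

theorem exists_isRightKanExtension [HasZeroObject C] [HasZeroMorphisms C]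
    (hball : ∀ V ∈ B, IsBall n V) (G : (BasisSub n B k)ᵒᵖ ⥤ C) :
    ∃ (H : (Opens M)ᵒᵖ ⥤ C) (α : (IsoSub.ι n (IsDisjUnion B k)).op ⋙ H ⟶ G),
      Functor.IsRightKanExtension (L := (basisIncl n hball k).op)
        ((IsoSub.ι n (IsBallUnion n k)).op ⋙ H) α ∧
      (∀ U : Opens M, IsBallUnionLE n ((k : ℤ) - 1) U → IsZero (H.obj (op U))) ∧
      IsPolynomial n k H := by
  let L := (basisIncl n hball k).op
  let F := Functor.rightKanExtension L G
  let L' := (ObjectProperty.ι (IsBallUnionLE (M := M) n (k : ℤ))).op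
  let H := Functor.rightKanExtension L' (zeroExt F)
  let ε := Functor.rightKanExtensionCounit L' (zeroExt F)
  -- Extension along a fully faithful inclusion does not change the values on the subcategory.
  have : IsIso ε := Functor.RightExtension.IsPointwiseRightKanExtension.isIso_hom
    (E := Functor.RightExtension.mk H ε)
    (Functor.isPointwiseRightKanExtensionOfIsRightKanExtension H ε)
  let e := ballSubIso (asIso ε)
  refine ⟨H, Functor.whiskerLeft L e.hom ≫ Functor.rightKanExtensionCounit L G, ?_, ?_, ?_⟩
  · refine Functor.isRightKanExtension_of_iso e.symm (Functor.rightKanExtensionCounit L G) _ ?_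
    ext U
    exact Iso.inv_hom_id_app_assoc e _ _
  · intro U hU
    have hU' : IsBallUnionLE n (k : ℤ) U := hU.mono (by omega)
    have h : IsZero (zeroExtObj F U) := isZero_zeroExtObj F fun h => h.not_isBallUnionLE hU
    exact h.of_iso ((asIso ε).app (op ⟨U, hU'⟩))
  · exact isPolynomial_of_isLimit fun U => nonempty_isLimit_smallCone ε U

variable (hbasis : Opens.IsBasis B) (hball : ∀ V ∈ B, IsBall n V)
include hbasis hball

theorem isVGHomogeneous_iff [HasZeroMorphisms C] [IsManifold (𝓡 n) ∞ M]
    (G : VGBasis n C B k) (H : (Opens M)ᵒᵖ ⥤ C)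
    (α : (IsoSub.ι n (IsDisjUnion B k)).op ⋙ H ⟶ G.obj) :
    (IsVGHomogeneous n k H ∧ IsIso α) ↔
      (Functor.IsRightKanExtension (L := (basisIncl n hball k).op)
          ((IsoSub.ι n (IsBallUnion n k)).op ⋙ H) α ∧
        (∀ U : Opens M, IsBallUnionLE n ((k : ℤ) - 1) U → IsZero (H.obj (op U))) ∧
        IsPolynomial n k H) := by
  constructor
  · rintro ⟨⟨hvg, hpoly, hzero⟩, hα⟩
    refine ⟨?_, fun U hU => isZero_of_isZero_polyApprox hU (hzero U), hpoly⟩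
    exact isRightKanExtension_of_isIso hbasis hball G.property
      (F := (IsoSub.ι n (IsBallUnion n k)).op ⋙ H) α
      (fun a b f hf => hvg ((IsoSub.ι n (IsBallUnion n k)).map f) hf) hα
  · rintro ⟨hkan, hzero, hpoly⟩
    refine ⟨⟨?_, hpoly, isZero_polyApprox hzero⟩,
      isIso_of_isRightKanExtension hbasis hball G.property
        (F := (IsoSub.ι n (IsBallUnion n k)).op ⋙ H) α⟩
    have hvg := isVeryGood_of_isRightKanExtension hbasis hball G.property
        (F := (IsoSub.ι n (IsBallUnion n k)).op ⋙ H) α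
    exact fun a b f hf => isIso_map_of_isIsotopyEquiv (isBasis_isBall hbasis hball) hvg hzero
      hpoly.nonempty_isLimit (leOfHom f) hf

theorem isEquivalence_restriction [HasZeroObject C] [HasZeroMorphisms C] [IsManifold (𝓡 n) ∞ M] :
    (restriction n C B k).IsEquivalence := by
  have hkan : ∀ X : VGHomogeneous n M C k,
      Functor.IsRightKanExtension (L := (basisIncl n hball k).op)
        ((IsoSub.ι n (IsBallUnion n k)).op ⋙ X.obj) (𝟙 ((restriction n C B k).obj X).obj) :=
    fun X => ((isVGHomogeneous_iff hbasis hball ((restriction n C B k).obj X) X.obj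
      (𝟙 _)).mp ⟨X.property, IsIso.id _⟩).1
  have hzero : ∀ (X : VGHomogeneous n M C k) (U : Opens M),
      IsBallUnionLE n ((k : ℤ) - 1) U → IsZero (X.obj.obj (op U)) :=
    fun X U hU => isZero_of_isZero_polyApprox hU (X.property.2.2 U)
  refine { faithful := ⟨fun {X Y} f g hfg => ?_⟩, full := ⟨fun {X Y} f => ?_⟩,
           essSurj := ⟨fun G => ?_⟩ }
  -- Faithfulness: uniqueness for the Kan extension passes from the basis to unions of `k` balls,
  -- and `hom_ext_of_ballSub` from there to all open sets. Fullness below uses existence in the same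
  -- two stages.
  · have := hkan Y
    have h : Functor.whiskerLeft (IsoSub.ι n (IsBallUnion n k)).op f.hom =
        Functor.whiskerLeft (IsoSub.ι n (IsBallUnion n k)).op g.hom := by
      refine Functor.hom_ext_of_isRightKanExtension
        (F' := (IsoSub.ι n (IsBallUnion n k)).op ⋙ Y.obj) (L := (basisIncl n hball k).op)
        (𝟙 ((restriction n C B k).obj Y).obj) _ _ ?_
      exact congrArg (fun t => t.hom ≫ 𝟙 ((restriction n C B k).obj Y).obj) hfg
    refine ObjectProperty.hom_ext _ ?_
    exact hom_ext_of_ballSub Y.property.2.1.nonempty_isLimit (hzero Y)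
      fun V => NatTrans.congr_app h (op V)
  · have := hkan Y
    let γ := Functor.liftOfIsRightKanExtension
      ((IsoSub.ι n (IsBallUnion n k)).op ⋙ Y.obj) (L := (basisIncl n hball k).op)
      (𝟙 ((restriction n C B k).obj Y).obj) ((IsoSub.ι n (IsBallUnion n k)).op ⋙ X.obj) f.hom
    obtain ⟨Γ, hΓ⟩ := exists_hom_of_ballSub Y.property.2.1.nonempty_isLimit (hzero Y) (hzero X) γ
    refine ⟨ObjectProperty.homMk Γ, ObjectProperty.hom_ext _ (NatTrans.ext (funext fun U => ?_))⟩
    have e := Functor.liftOfIsRightKanExtension_fac_app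
      ((IsoSub.ι n (IsBallUnion n k)).op ⋙ Y.obj) (L := (basisIncl n hball k).op)
      (𝟙 ((restriction n C B k).obj Y).obj) ((IsoSub.ι n (IsBallUnion n k)).op ⋙ X.obj) f.hom U
    exact (hΓ ((basisIncl n hball k).obj U.unop)).trans ((Category.comp_id _).symm.trans e)
  · obtain ⟨H, α, h⟩ := exists_isRightKanExtension hball G.obj
    obtain ⟨hH, hα⟩ := (isVGHomogeneous_iff hbasis hball G H α).mpr h
    exact ⟨⟨H, hH⟩, ⟨ObjectProperty.isoMk _ (@asIso _ _ _ _ α hα)⟩⟩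

end Equivalence

end VeryGood


theorem theorem3p5 {n : ℕ} {M : Type u} [TopologicalSpace M] [T2Space M]
    [ChartedSpace (EuclideanSpace ℝ (Fin n)) M] [IsManifold (𝓡 n) ∞ M]
    (B : Set (Opens M)) (hbasis : Opens.IsBasis B) (hball : ∀ V ∈ B, VeryGood.IsBall n V)
    {C : Type v} [Category.{w} C] [HasZeroObject C] [HasLimitsOfSize.{u, u} C] (k : ℕ) :
    (VeryGood.restriction n C B k).IsEquivalence ∧
    ∀ (G : VeryGood.VGBasis n C B k) (H : (Opens M)ᵒᵖ ⥤ C)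
      (α : (VeryGood.IsoSub.ι n (VeryGood.IsDisjUnion B k)).op ⋙ H ⟶ G.obj),
      (VeryGood.IsVGHomogeneous n k H ∧ IsIso α) ↔
        (Functor.IsRightKanExtension (L := (VeryGood.basisIncl n hball k).op)
            ((VeryGood.IsoSub.ι n (VeryGood.IsBallUnion n k)).op ⋙ H) α ∧
          (∀ U : Opens M, VeryGood.IsBallUnionLE n ((k : ℤ) - 1) U → IsZero (H.obj (op U))) ∧
          VeryGood.IsPolynomial n k H) := by
  -- Zero morphisms, used throughout the proof, are those factoring through the zero object.
  let : HasZeroMorphisms C := HasZeroObject.zeroMorphismsOfZeroObject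
  exact ⟨VeryGood.isEquivalence_restriction hbasis hball,
    VeryGood.isVGHomogeneous_iff hbasis hball⟩
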